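/- **Setting.** Let $\widetilde h_k(u)=\pi^{-1/4}((k-1)!)^{-1/2}\,\mathrm{He}_{k-1}(\sqrt2\,u)\,e^{-u^2/2}$, $k=1,2,\dots$, be the Hermite functions (with $\mathrm{He}_n(u)=(-1)^n e^{u^2/2}\frac{d^n}{du^n}e^{-u^2/2}$), an orthonormal basis of the complex Hilbert space $\mathbf L_2(\mathbb R,dx)$. For $p\in\mathbb Z$ let $\mathcal H_p=\{\sum_k f_k\widetilde h_k:\ \sum_k|f_k|^2(2k)^p<\infty\}$, so that $\mathcal H_0=\mathbf L_2(\mathbb R,dx)$, and let $\Gamma(\mathcal H_p)=\bigoplus_{n\ge0}\mathcal H_p^{\otimes n}$ be its full Fock space. In coordinates, $\Gamma(\mathcal H_p)$ consists of the families $(f_\alpha)$, indexed by the finite words $\alpha=k_1\cdots k_n$ ($n\ge 0$, $k_i\ge1$), with $\|f\|^2=\sum_\alpha|f_\alpha|^2\prod_{i}(2k_i)^p<\infty$. Put $$\widetilde{\mathcal S}_1=\bigcap_{p\in\mathbb N}\Gamma(\mathcal H_p)\ \subset\ \Gamma(\mathcal H_0)\ \subset\ \widetilde{\mathcal S}_{-1}=\bigcup_{p\in\mathbb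 N}\Gamma(\mathcal H_{-p}),$$ with the projective limit topology on $\widetilde{\mathcal S}_1$ and the (locally convex) inductive limit topology on $\widetilde{\mathcal S}_{-1}$. Let $\mathcal L(\widetilde{\mathcal S}_1,\widetilde{\mathcal S}_{-1})$ be the space of continuous linear maps. For $h\in\mathbf L_2(\mathbb R,dx)$ let $\ell_h f=h\otimes f$ on $\Gamma(\mathcal H_0)$, and let $\ell_h^*$ be its Hilbert space adjoint. Let $m:\mathbb R\to[0,\infty)$ be measurable with $\int_{\mathbb R}\frac{m(u)}{1+u^2}\,du<\infty$, and let $T_m$ be the operator in $\mathbf L_2(\mathbb R,dx)$ given by $\widehat{T_mf}(u)=\sqrt{m(u)}\,\widehat f(u)$ on $\{f:\int m|\widehat f|^2<\infty\}$, where $\widehat f(u)=\int e^{-iux}f(x)\,dx$. For $t<0$ let $1_{[0,t]}$ stand for $-1_{[t,0]}$. **Theorem.** Assume moreover that there are $K\in(0,\infty)$, $b<2$ and $N\in\{0,1,2,\dots\}$ with $$m(u)\le K|u|^{-b}\quad(0<|u|\le1),\qquad m(u)\le K|u|^{2N}\quad(|u|>1).$$ Then $1_{[0,t]}$ belongs to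 the domain of $T_m$ for every $t\in\mathbb R$, and the free process $$X_m(t)=\ell_{T_m1_{[0,t]}}+\ell_{T_m1_{[0,t]}}^*,\qquad t\in\mathbb R,$$ of bounded operators on $\Gamma(\mathcal H_0)$ is differentiable in the following sense: there is a function $W_m:\mathbb R\to\mathcal L(\widetilde{\mathcal S}_1,\widetilde{\mathcal S}_{-1})$ such that for every $f\in\widetilde{\mathcal S}_1$ and every $t\in\mathbb R$ $$\frac{d}{dt}X_m(t)f=\lim_{h\to0}\frac{X_m(t+h)f-X_m(t)f}{h}=W_m(t)f\quad\text{in the topology of }\widetilde{\mathcal S}_{-1}.$$ -/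

import Mathlib

open MeasureTheory Filter Topology
open scoped ENNReal FourierTransform InnerProductSpace

noncomputable section

namespace FreeNoise

/-! ## Weighted `ℓ²` spaces -/

section WeightedL2

variable {ι : Type}

/-- The families `(f i)` of complex numbers with `∑ i, |f i|² a i < ∞`, for a weight `a > 0`. -/
def weightedSubmodule (a : ι → ℝ) [ha : Fact (∀ i, 0 < a i)] : Submodule ℂ (ι → ℂ) where
  carrier := {f | Summable fun i => ‖f i‖ ^ 2 * a i}
  zero_mem' := by
    simp
  add_mem' := by
    intro f g hf hg
    simp only [Set.mem_ofPred_eq] at hf hg ⊢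
    refine Summable.of_nonneg_of_le (fun i => mul_nonneg (sq_nonneg _) (ha.out i).le) (fun i => ?_)
      ((hf.add hg).mul_left 2)
    have h1 : ‖(f + g) i‖ ≤ ‖f i‖ + ‖g i‖ := norm_add_le _ _
    have h2 : ‖(f + g) i‖ ^ 2 ≤ 2 * (‖f i‖ ^ 2 + ‖g i‖ ^ 2) := by
      nlinarith [norm_nonneg ((f + g) i), sq_nonneg (‖f i‖ - ‖g i‖),
        norm_nonneg (f i), norm_nonneg (g i)]
    nlinarith [mul_le_mul_of_nonneg_right h2 (ha.out i).le]
  smul_mem' := by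
    intro c f hf
    simp only [Set.mem_ofPred_eq] at hf ⊢
    refine (hf.mul_left (‖c‖ ^ 2)).congr (fun i => ?_)
    simp only [Pi.smul_apply, smul_eq_mul, norm_mul]
    ring

/-- The Hilbert space `ℓ²(ι, a)` of families with `∑ i, |f i|² a i < ∞`. -/
def WeightedL2 (a : ι → ℝ) [Fact (∀ i, 0 < a i)] : Type := ↥(weightedSubmodule a)

variable (a : ι → ℝ) [ha : Fact (∀ i, 0 < a i)]

instance : AddCommGroup (WeightedL2 a) := inferInstanceAs (AddCommGroup ↥(weightedSubmodule a))

instance : Module ℂ (WeightedL2 a) := inferInstanceAs (Module ℂ ↥(weightedSubmodule a))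

/-- The family of coefficients of an element of `ℓ²(ι, a)`. -/
def coeff : WeightedL2 a →ₗ[ℂ] (ι → ℂ) := (weightedSubmodule a).subtype

theorem coeff_injective : Function.Injective (coeff a) := Subtype.val_injective

/-- A family with `∑ i, |f i|² a i < ∞`, as an element of `ℓ²(ι, a)`. -/
def ofCoeff (f : ι → ℂ) (hf : Summable fun i => ‖f i‖ ^ 2 * a i) : WeightedL2 a := ⟨f, hf⟩

theorem coeff_ofCoeff (f : ι → ℂ) (hf : Summable fun i => ‖f i‖ ^ 2 * a i) :
    coeff a (ofCoeff a f hf) = f := rfl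

theorem summable_coeff (f : WeightedL2 a) : Summable fun i => ‖coeff a f i‖ ^ 2 * a i := f.2

theorem norm_scaled_sq (f : ι → ℂ) (i : ι) :
    ‖(Real.sqrt (a i) : ℂ) * f i‖ ^ 2 = ‖f i‖ ^ 2 * a i := by
  rw [norm_mul, mul_pow, Complex.norm_real, Real.norm_eq_abs, sq_abs,
    Real.sq_sqrt (ha.out i).le, mul_comm]

/-- The map `(f i) ↦ (√(a i) f i)` from `ℓ²(ι, a)` to the unweighted `ℓ²(ι)`. -/
def scale : WeightedL2 a →ₗ[ℂ] lp (fun _ : ι => ℂ) 2 where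
  toFun f := ⟨fun i => (Real.sqrt (a i) : ℂ) * coeff a f i, by
    refine (memℓp_gen_iff (by norm_num)).2 ((summable_coeff a f).congr (fun i => ?_))
    rw [← norm_scaled_sq a (coeff a f) i]
    norm_num⟩
  map_add' f g := by
    ext i
    exact mul_add _ _ _
  map_smul' c f := by
    ext i
    exact mul_left_comm _ _ _

theorem scale_apply (f : WeightedL2 a) (i : ι) :
    (scale a f) i = (Real.sqrt (a i) : ℂ) * coeff a f i := rfl

theorem sqrt_weight_ne_zero (i : ι) : (Real.sqrt (a i) : ℂ) ≠ 0 := by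
  simpa using (Real.sqrt_pos.2 (ha.out i)).ne'

theorem scale_injective : Function.Injective (scale a) := by
  intro f g h
  refine coeff_injective a (funext fun i => ?_)
  have h1 : (scale a f) i = (scale a g) i := by rw [h]
  exact mul_left_cancel₀ (sqrt_weight_ne_zero a i) h1

theorem scale_surjective : Function.Surjective (scale a) := by
  intro g
  have hg : Summable fun i => ‖g i‖ ^ 2 := by
    have := (memℓp_gen_iff (p := 2) (by norm_num)).1 g.2
    exact this.congr (fun i => by norm_num)
  refine ⟨ofCoeff a (fun i => (Real.sqrt (a i) : ℂ)⁻¹ * g i) ?_, ?_⟩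
  · refine hg.congr (fun i => ?_)
    rw [← norm_scaled_sq a (fun i => (Real.sqrt (a i) : ℂ)⁻¹ * g i) i,
      mul_inv_cancel_left₀ (sqrt_weight_ne_zero a i)]
  · ext i
    exact mul_inv_cancel_left₀ (sqrt_weight_ne_zero a i) _

instance : NormedAddCommGroup (WeightedL2 a) :=
  NormedAddCommGroup.induced (WeightedL2 a) (lp (fun _ : ι => ℂ) 2) (scale a) (scale_injective a)

theorem norm_scale (f : WeightedL2 a) : ‖scale a f‖ = ‖f‖ := rfl

instance : NormedSpace ℂ (WeightedL2 a) :=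
  NormedSpace.induced ℂ (WeightedL2 a) (lp (fun _ : ι => ℂ) 2) (scale a)

/-- The inner product `⟪f, g⟫ = ∑ i, conj (f i) g i a i`, linear in the second variable. -/
instance : InnerProductSpace ℂ (WeightedL2 a) where
  inner f g := ⟪scale a f, scale a g⟫_ℂ
  norm_sq_eq_re_inner f := by
    rw [← norm_scale]
    exact norm_sq_eq_re_inner (𝕜 := ℂ) (scale a f)
  conj_inner_symm f g := inner_conj_symm _ _
  add_left f g h := by rw [map_add, inner_add_left]
  smul_left f g c := by rw [map_smul, inner_smul_left]

instance : CompleteSpace (WeightedL2 a) := by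
  let e : WeightedL2 a ≃ₗᵢ[ℂ] lp (fun _ : ι => ℂ) 2 :=
    { LinearEquiv.ofBijective (scale a) ⟨scale_injective a, scale_surjective a⟩ with
      norm_map' := norm_scale a }
  exact (completeSpace_congr (e := e.toLinearEquiv.toEquiv) e.isometry.isUniformEmbedding).2
    inferInstance

theorem norm_sq_eq (f : WeightedL2 a) : ‖f‖ ^ 2 = ∑' i, ‖coeff a f i‖ ^ 2 * a i := by
  have h := lp.norm_rpow_eq_tsum (p := 2) (by norm_num) (scale a f)
  rw [norm_scale] at h
  norm_num at h
  rw [h]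
  exact tsum_congr (fun i => norm_scaled_sq a (coeff a f) i)

end WeightedL2

/-! ## Full Fock spaces and the free field operators -/

section Fock

variable {ι : Type}

/-- The weight of the word `i₁ i₂ ⋯ iₙ` is `a i₁ * a i₂ * ⋯ * a iₙ`. -/
def wordWeight (a : ι → ℝ) (w : List ι) : ℝ := (w.map a).prod

instance (a : ι → ℝ) [ha : Fact (∀ i, 0 < a i)] : Fact (∀ w, 0 < wordWeight a w) :=
  ⟨fun w => by
    unfold wordWeight
    refine List.prod_pos ?_
    intro x hx
    obtain ⟨i, _, rfl⟩ := List.mem_map.1 hx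
    exact ha.out i⟩

/-- The full Fock space `⨁ₙ K^{⊗n}` of `K = ℓ²(ι, a)`, which has the orthogonal basis
`e_i`, `i ∈ ι`, with `‖e_i‖² = a i`. The coefficient at the word `i₁ ⋯ iₙ` is the one of
`e_{i₁} ⊗ ⋯ ⊗ e_{iₙ}`, a vector of square norm `a i₁ ⋯ a iₙ`, and the empty word belongs to the
vacuum `Ω`. -/
abbrev Fock (a : ι → ℝ) [Fact (∀ i, 0 < a i)] : Type := WeightedL2 (wordWeight a)

/-- The coefficients of `c ⊗ f`. -/
def tensorCoeff (c : ι → ℂ) (f : List ι → ℂ) : List ι → ℂ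
  | [] => 0
  | i :: w => c i * f w

variable (a : ι → ℝ) [ha : Fact (∀ i, 0 < a i)]

theorem hasSum_tensorCoeff (c : WeightedL2 a) (f : Fock a) :
    HasSum (fun w => ‖tensorCoeff (coeff a c) (coeff (wordWeight a) f) w‖ ^ 2 * wordWeight a w)
      (‖c‖ ^ 2 * ‖f‖ ^ 2) := by
  have hinj : Function.Injective (fun x : ι × List ι => x.1 :: x.2) := by
    rintro ⟨i, w⟩ ⟨j, v⟩ h
    simpa using h
  rw [← hinj.hasSum_iff]
  · have hc := (summable_coeff a c).hasSum
    have hf := (summable_coeff (wordWeight a) f).hasSum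
    rw [← norm_sq_eq] at hc hf
    have hs : Summable fun x : ι × List ι =>
        (‖coeff a c x.1‖ ^ 2 * a x.1) *
          (‖coeff (wordWeight a) f x.2‖ ^ 2 * wordWeight a x.2) :=
      (summable_coeff a c).mul_of_nonneg (summable_coeff (wordWeight a) f)
        (fun i => mul_nonneg (sq_nonneg _) (ha.out i).le)
        (fun w => mul_nonneg (sq_nonneg _)
          ((inferInstance : Fact (∀ w, 0 < wordWeight a w)).out w).le)
    have key := hc.mul hf hs
    refine key.congr_fun fun x => ?_
    simp only [Function.comp_apply]
    simp only [tensorCoeff, wordWeight, List.map_cons, List.prod_cons, norm_mul]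
    ring
  · intro w hw
    cases w with
    | nil => simp [tensorCoeff]
    | cons i w => exact absurd ⟨(i, w), rfl⟩ hw

/-- The left creation operator `ℓ_c f = c ⊗ f` on the full Fock space of `ℓ²(ι, a)`. -/
def creation (c : WeightedL2 a) : Fock a →L[ℂ] Fock a :=
  LinearMap.mkContinuous
    { toFun := fun f => ofCoeff (wordWeight a)
        (tensorCoeff (coeff a c) (coeff (wordWeight a) f)) (hasSum_tensorCoeff a c f).summable
      map_add' := fun f g => by
        refine coeff_injective (wordWeight a) (funext fun w => ?_)
        cases w with
        | nil => exact (add_zero (0 : ℂ)).symm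
        | cons i w => exact mul_add _ _ _
      map_smul' := fun r f => by
        refine coeff_injective (wordWeight a) (funext fun w => ?_)
        cases w with
        | nil => exact (smul_zero r : r • (0 : ℂ) = 0).symm
        | cons i w => exact mul_left_comm _ _ _ }
    ‖c‖
    (fun f => by
      refine abs_le_of_sq_le_sq' ?_ (by positivity) |>.2
      rw [norm_sq_eq, mul_pow]
      exact (hasSum_tensorCoeff a c f).tsum_eq.le)

/-- The operator `X_c = ℓ_c + ℓ_c^*`, with the Hilbert space adjoint in the Fock space. -/
def freeField (c : WeightedL2 a) : Fock a →L[ℂ] Fock a :=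
  creation a c + ContinuousLinearMap.adjoint (creation a c)

end Fock

/-! ## Hermite functions -/

section Hermite

open Polynomial

theorem integrable_poly_gauss (P : Polynomial ℝ) {c : ℝ} (hc : 0 < c) :
    Integrable fun x : ℝ => P.eval x * Real.exp (-c * x ^ 2) := by
  induction P using Polynomial.induction_on' with
  | add p q hp hq =>
    refine (hp.add hq).congr (ae_of_all _ fun x => ?_)
    simp [add_mul]
  | monomial n r =>
    have h := (integrable_rpow_mul_exp_neg_mul_sq hc (s := n)
      (by have : (0 : ℝ) ≤ n := Nat.cast_nonneg n
          linarith)).const_mul r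
    refine h.congr (ae_of_all _ fun x => ?_)
    simp [Real.rpow_natCast, mul_assoc]

/-- The Hermite polynomials with real coefficients. -/
def hermiteR (n : ℕ) : Polynomial ℝ := (hermite n).map (Int.castRingHom ℝ)

theorem hermiteR_succ (n : ℕ) : hermiteR (n + 1) = X * hermiteR n - derivative (hermiteR n) := by
  simp [hermiteR, hermite_succ, derivative_map]

theorem integral_hermite_succ (n : ℕ) (Q : Polynomial ℝ) :
    ∫ x : ℝ, (hermiteR (n + 1) * Q).eval x * Real.exp (-(1 / 2) * x ^ 2) =
      ∫ x : ℝ, (hermiteR n * derivative Q).eval x * Real.exp (-(1 / 2) * x ^ 2) := by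
  have hd : ∀ x : ℝ, HasDerivAt
      (fun x => (hermiteR n * Q).eval x * Real.exp (-(1 / 2) * x ^ 2))
      ((hermiteR n * derivative Q - hermiteR (n + 1) * Q).eval x
        * Real.exp (-(1 / 2) * x ^ 2)) x := by
    intro x
    have h1 := (hermiteR n * Q).hasDerivAt x
    have h2 : HasDerivAt (fun x : ℝ => Real.exp (-(1 / 2) * x ^ 2))
        (Real.exp (-(1 / 2) * x ^ 2) * (-(1 / 2) * (2 * x))) x := by
      have := ((hasDerivAt_pow 2 x).const_mul (-(1 / 2) : ℝ)).exp
      simpa using this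
    refine (h1.mul h2).congr_deriv ?_
    simp only [hermiteR_succ, derivative_mul, eval_sub, eval_mul, eval_add, eval_X]
    ring
  have h0 : ∫ x : ℝ, (hermiteR n * derivative Q - hermiteR (n + 1) * Q).eval x *
      Real.exp (-(1 / 2) * x ^ 2) = 0 := integral_eq_zero_of_hasDerivAt_of_integrable hd
    (integrable_poly_gauss _ (by norm_num)) (integrable_poly_gauss _ (by norm_num))
  have h1 := integral_sub (integrable_poly_gauss (hermiteR n * derivative Q)
    (c := 1 / 2) (by norm_num)) (integrable_poly_gauss (hermiteR (n + 1) * Q) (c := 1 / 2) (by norm_num))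
  rw [← sub_eq_zero, ← neg_sub, ← h1, neg_eq_zero, ← h0]
  refine integral_congr_ae (ae_of_all _ fun x => ?_)
  beta_reduce
  rw [eval_sub, sub_mul]

theorem integral_hermite_mul (n : ℕ) (Q : Polynomial ℝ) :
    ∫ x : ℝ, (hermiteR n * Q).eval x * Real.exp (-(1 / 2) * x ^ 2) =
      ∫ x : ℝ, (derivative^[n] Q).eval x * Real.exp (-(1 / 2) * x ^ 2) := by
  induction n generalizing Q with
  | zero => simp [hermiteR]
  | succ n ih => rw [integral_hermite_succ, ih, Function.iterate_succ_apply]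

theorem hermiteR_natDegree (n : ℕ) : (hermiteR n).natDegree = n := by
  rw [hermiteR, (hermite_monic n).natDegree_map, natDegree_hermite]

theorem integral_hermite_hermite {m n : ℕ} (h : m ≤ n) :
    ∫ x : ℝ, (hermiteR n * hermiteR m).eval x * Real.exp (-(1 / 2) * x ^ 2) =
      if m = n then (n.factorial : ℝ) * Real.sqrt (2 * Real.pi) else 0 := by
  rw [integral_hermite_mul]
  split_ifs with hmn
  · subst hmn
    have h1 : derivative^[m] (hermiteR m) = C (m.factorial : ℝ) := by
      have hdeg : (derivative^[m] (hermiteR m)).natDegree ≤ 0 := by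
        refine (natDegree_iterate_derivative _ _).trans ?_
        rw [hermiteR_natDegree]
        omega
      rw [eq_C_of_natDegree_le_zero hdeg, coeff_iterate_derivative]
      have hmon : (hermiteR m).coeff m = 1 := by
        simp [hermiteR]
      simp [hmon, Nat.descFactorial_self]
    rw [h1]
    simp only [eval_C]
    rw [integral_const_mul, integral_gaussian]
    congr 2
    ring
  · rw [iterate_derivative_eq_zero (by rw [hermiteR_natDegree]; omega)]
    simp

/-- The Hermite functions `π^{-1/4} (n!)^{-1/2} Heₙ(√2 u) e^{-u²/2}`, `n = 0, 1, 2, …`. -/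
def hermiteFun (n : ℕ) (u : ℝ) : ℝ :=
  aeval (Real.sqrt 2 * u) (hermite n) * Real.exp (-u ^ 2 / 2) /
    (Real.pi ^ (1 / 4 : ℝ) * Real.sqrt n.factorial)

theorem hermiteFun_mul (m n : ℕ) (u : ℝ) :
    hermiteFun n u * hermiteFun m u =
      ((hermiteR n * hermiteR m).eval (Real.sqrt 2 * u) *
        Real.exp (-(1 / 2) * (Real.sqrt 2 * u) ^ 2)) *
      (Real.pi ^ (1 / 2 : ℝ) * (Real.sqrt n.factorial * Real.sqrt m.factorial))⁻¹ := by
  have h1 : ∀ n : ℕ, aeval (Real.sqrt 2 * u) (hermite n) = (hermiteR n).eval (Real.sqrt 2 * u) := by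
    intro n
    simp [hermiteR, aeval_def, eval_map]
  have h2 : Real.exp (-(1 / 2) * (Real.sqrt 2 * u) ^ 2) =
      Real.exp (-u ^ 2 / 2) * Real.exp (-u ^ 2 / 2) := by
    rw [← Real.exp_add, mul_pow, Real.sq_sqrt (by norm_num)]
    congr 1
    ring
  have h3 : Real.pi ^ (1 / 2 : ℝ) = Real.pi ^ (1 / 4 : ℝ) * Real.pi ^ (1 / 4 : ℝ) := by
    rw [← Real.rpow_add Real.pi_pos]
    norm_num
  rw [h2, h3]
  simp only [hermiteFun, h1, eval_mul, div_eq_mul_inv, mul_inv]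
  ring

theorem integrable_hermiteFun_mul (m n : ℕ) :
    Integrable fun u => hermiteFun n u * hermiteFun m u := by
  simp only [hermiteFun_mul]
  exact ((integrable_poly_gauss _ (by norm_num)).comp_mul_left' (by positivity)).mul_const _

theorem integral_hermiteFun_mul (m n : ℕ) :
    ∫ u, hermiteFun n u * hermiteFun m u = if m = n then 1 else 0 := by
  wlog h : m ≤ n generalizing m n with H
  · have := H n m (by omega)
    simp only [mul_comm (hermiteFun n _)]
    rw [this]
    simp only [eq_comm]
  simp only [hermiteFun_mul]
  rw [integral_mul_const, Measure.integral_comp_mul_left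
    (fun x => (hermiteR n * hermiteR m).eval x * Real.exp (-(1 / 2) * x ^ 2)),
    integral_hermite_hermite h]
  split_ifs with hmn
  · subst hmn
    rw [abs_of_pos (by positivity), Real.mul_self_sqrt (by positivity), ← Real.sqrt_eq_rpow,
      Real.sqrt_mul (by norm_num), smul_eq_mul]
    have := Real.pi_pos
    field_simp
  · simp

theorem continuous_hermiteFun (n : ℕ) : Continuous (hermiteFun n) := by
  unfold hermiteFun
  have : Continuous fun u : ℝ => aeval (Real.sqrt 2 * u) (hermite n) :=
    (Polynomial.continuous_aeval _).comp (by fun_prop)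
  fun_prop

theorem memLp_hermiteFun (n : ℕ) : MemLp (fun u => (hermiteFun n u : ℂ)) 2 := by
  suffices h : MemLp (hermiteFun n) 2 from h.ofReal
  rw [memLp_two_iff_integrable_sq (continuous_hermiteFun n).aestronglyMeasurable]
  simpa [sq] using integrable_hermiteFun_mul n n

/-- The Hermite functions as elements of the complex Hilbert space `L²(ℝ)`. -/
def hermiteLp (n : ℕ) : Lp ℂ 2 (volume : Measure ℝ) := (memLp_hermiteFun n).toLp _

theorem orthonormal_hermiteLp : Orthonormal ℂ hermiteLp := by
  rw [orthonormal_iff_ite]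
  intro m n
  rw [L2.inner_def]
  have h : (fun u => ⟪hermiteLp m u, hermiteLp n u⟫_ℂ) =ᵐ[volume]
      fun u => ((hermiteFun m u * hermiteFun n u : ℝ) : ℂ) := by
    filter_upwards [(memLp_hermiteFun m).coeFn_toLp, (memLp_hermiteFun n).coeFn_toLp] with u h1 h2
    rw [hermiteLp, hermiteLp, h1, h2]
    simp [mul_comm]
  rw [integral_congr_ae h, integral_complex_ofReal, integral_hermiteFun_mul]
  simp only [eq_comm (a := n)]
  split_ifs <;> simp

end Hermite

/-! ## The spaces `H_p`, `Γ(H_p)` and the non-commutative Kondratiev spaces -/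

section Kondratiev

/-- The weight `(2k)^p` of the `k`-th Hermite function, `k = n + 1 = 1, 2, …`. -/
def hermiteWeight (p : ℤ) (n : ℕ) : ℝ := (2 * ((n : ℝ) + 1)) ^ p

instance (p : ℤ) : Fact (∀ n, 0 < hermiteWeight p n) :=
  ⟨fun n => zpow_pos (by positivity) p⟩

/-- `H_p`, given by the Hermite coefficients: `∑ |f_k|² (2k)^p < ∞`. -/
abbrev HermiteSpace (p : ℤ) : Type := WeightedL2 (hermiteWeight p)

/-- The full Fock space `Γ(H_p)`. -/
abbrev FockH (p : ℤ) : Type := Fock (hermiteWeight p)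

/-- The families of coefficients of the elements of `Γ(H_p)`. -/
abbrev fockSubmodule (p : ℤ) : Submodule ℂ (List ℕ → ℂ) :=
  weightedSubmodule (wordWeight (hermiteWeight p))

theorem one_le_wordWeight {p : ℤ} (hp : 0 ≤ p) (w : List ℕ) :
    1 ≤ wordWeight (hermiteWeight p) w := by
  induction w with
  | nil => simp [wordWeight]
  | cons n w ih =>
    have h : 1 ≤ hermiteWeight p n := one_le_zpow₀ (by linarith [(Nat.cast_nonneg n : (0:ℝ) ≤ n)]) hp
    simpa [wordWeight] using one_le_mul_of_one_le_of_one_le h ih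

theorem wordWeight_mono {p q : ℤ} (h : p ≤ q) (w : List ℕ) :
    wordWeight (hermiteWeight p) w ≤ wordWeight (hermiteWeight q) w := by
  induction w with
  | nil => simp [wordWeight]
  | cons n w ih =>
    have h1 : hermiteWeight p n ≤ hermiteWeight q n :=
      zpow_le_zpow_right₀ (by linarith [(Nat.cast_nonneg n : (0:ℝ) ≤ n)]) h
    have hp := (inferInstance : Fact (∀ n, 0 < hermiteWeight q n)).out n
    have hw := (inferInstance : Fact (∀ w, 0 < wordWeight (hermiteWeight p) w)).out w
    simpa [wordWeight] using mul_le_mul h1 ih hw.le hp.le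

theorem fockSubmodule_anti {p q : ℤ} (h : p ≤ q) : fockSubmodule q ≤ fockSubmodule p := by
  intro f hf
  exact Summable.of_nonneg_of_le
    (fun w => mul_nonneg (sq_nonneg _)
      ((inferInstance : Fact (∀ w, 0 < wordWeight (hermiteWeight p) w)).out w).le)
    (fun w => mul_le_mul_of_nonneg_left (wordWeight_mono h w) (sq_nonneg _)) hf

/-- The families of coefficients of the elements of `⋂ₚ Γ(H_p)`. -/
def testSubmodule : Submodule ℂ (List ℕ → ℂ) := ⨅ p : ℕ, fockSubmodule p

/-- The families of coefficients of the elements of `⋃ₚ Γ(H_{-p})`. -/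
def distributionSubmodule : Submodule ℂ (List ℕ → ℂ) where
  carrier := {f | ∃ p : ℕ, f ∈ fockSubmodule (-(p : ℤ))}
  zero_mem' := ⟨0, zero_mem _⟩
  add_mem' := by
    rintro f g ⟨p, hf⟩ ⟨q, hg⟩
    refine ⟨max p q, add_mem (fockSubmodule_anti ?_ hf) (fockSubmodule_anti ?_ hg)⟩ <;>
      simp
  smul_mem' := by
    rintro c f ⟨p, hf⟩
    exact ⟨p, Submodule.smul_mem _ c hf⟩

/-- The space `S̃₁ = ⋂ₚ Γ(H_p)` of non-commutative stochastic test functions. -/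
def TestSpace : Type := ↥testSubmodule

instance : AddCommGroup TestSpace := inferInstanceAs (AddCommGroup ↥testSubmodule)

instance : Module ℂ TestSpace := inferInstanceAs (Module ℂ ↥testSubmodule)

/-- The inclusion of `S̃₁` into `Γ(H_p)`. -/
def testToFock (p : ℕ) : TestSpace →ₗ[ℂ] FockH p :=
  Submodule.inclusion (iInf_le (fun p : ℕ => fockSubmodule p) p)

/-- The projective limit topology: the coarsest one for which all the inclusions of `S̃₁` into the
Hilbert spaces `Γ(H_p)` are continuous. -/
instance : TopologicalSpace TestSpace :=
  ⨅ p : ℕ, TopologicalSpace.induced (testToFock p) inferInstance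

/-- The space `S̃₋₁ = ⋃ₚ Γ(H_{-p})` of non-commutative stochastic distributions. -/
def DistributionSpace : Type := ↥distributionSubmodule

instance : AddCommGroup DistributionSpace := inferInstanceAs (AddCommGroup ↥distributionSubmodule)

instance : Module ℂ DistributionSpace := inferInstanceAs (Module ℂ ↥distributionSubmodule)

/-- The inclusion of `Γ(H_{-p})` into `S̃₋₁`. -/
def fockToDistribution (p : ℕ) : FockH (-(p : ℤ)) →ₗ[ℂ] DistributionSpace :=
  Submodule.inclusion (p := fockSubmodule (-(p : ℤ))) (p' := distributionSubmodule)
    (fun _ hf => ⟨p, hf⟩)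

/-- The inductive limit topology: the finest locally convex vector space topology for which all the
inclusions of the Hilbert spaces `Γ(H_{-p})` into `S̃₋₁` are continuous. -/
instance : TopologicalSpace DistributionSpace :=
  sInf {τ | @IsTopologicalAddGroup DistributionSpace τ _ ∧ @ContinuousSMul ℂ DistributionSpace _ _ τ ∧
    @LocallyConvexSpace ℝ DistributionSpace _ _ _ _ τ ∧
    ∀ p : ℕ, @Continuous (FockH (-(p : ℤ))) DistributionSpace _ τ (fockToDistribution p)}

/-- The inclusion of the non-commutative white noise space `Γ(H_0)` into `S̃₋₁`. -/
def whiteNoiseToDistribution : FockH 0 →ₗ[ℂ] DistributionSpace :=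
  Submodule.inclusion (p := fockSubmodule 0) (p' := distributionSubmodule)
    (fun _ hf => ⟨0, by simpa using hf⟩)

/-- The inclusion of `S̃₁` into the non-commutative white noise space `Γ(H_0)`. -/
def testToWhiteNoise : TestSpace →ₗ[ℂ] FockH 0 := testToFock 0

end Kondratiev

/-! ## The process `X_m` -/

section FreeProc

/-- The Hilbert space `L²(ℝ, dx)` of complex valued functions. -/
abbrev L2R : Type := Lp ℂ 2 (volume : Measure ℝ)

/-- The identification of `L²(ℝ, dx)` with `H_0`: `g` is sent to `(⟪h_n, g⟫)_n`, the coefficients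
of `g = ∑ ⟪h_n, g⟫ h_n` in the basis of Hermite functions. -/
def hermiteCoeff (g : L2R) : HermiteSpace 0 :=
  ofCoeff (hermiteWeight 0) (fun n => ⟪hermiteLp n, g⟫_ℂ) (by
    simpa [hermiteWeight] using orthonormal_hermiteLp.inner_products_summable g)

/-- The function on the Fourier side that defines `T_m f`. Mathlib's transform
`𝓕 f v = ∫ exp(-2πixv) f(x) dx` is related to `f̂ u = ∫ exp(-iux) f(x) dx` by `𝓕 f v = f̂ (2πv)`, so
that the definition `(T_m f)^ u = √(m u) f̂ u` reads `𝓕 (T_m f) v = √(m (2πv)) 𝓕 f v`. -/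
def symbolMul (m : ℝ → ℝ) (f : L2R) (v : ℝ) : ℂ :=
  (Real.sqrt (m (2 * Real.pi * v)) : ℂ) * (𝓕 f : L2R) v

theorem symbolMul_add (m : ℝ → ℝ) (f g : L2R) :
    symbolMul m (f + g) =ᵐ[volume] symbolMul m f + symbolMul m g := by
  rw [show symbolMul m (f + g) = fun v => (Real.sqrt (m (2 * Real.pi * v)) : ℂ) *
    (𝓕 f + 𝓕 g : L2R) v by unfold symbolMul; rw [FourierTransform.fourier_add]]
  filter_upwards [Lp.coeFn_add (𝓕 f : L2R) (𝓕 g)] with v hv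
  simp only [hv, Pi.add_apply, symbolMul, mul_add]

theorem symbolMul_smul (m : ℝ → ℝ) (c : ℂ) (f : L2R) :
    symbolMul m (c • f) =ᵐ[volume] c • symbolMul m f := by
  rw [show symbolMul m (c • f) = fun v => (Real.sqrt (m (2 * Real.pi * v)) : ℂ) *
    (c • 𝓕 f : L2R) v by unfold symbolMul; rw [FourierTransform.fourier_smul]]
  filter_upwards [Lp.coeFn_smul c (𝓕 f : L2R)] with v hv
  simp only [hv, Pi.smul_apply, symbolMul, smul_eq_mul]
  ring

/-- The domain of `T_m`: those `f ∈ L²(ℝ)` with `√m f̂ ∈ L²(ℝ)`. -/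
def domT (m : ℝ → ℝ) : Submodule ℂ L2R where
  carrier := {f | MemLp (symbolMul m f) 2 volume}
  zero_mem' := by
    have h := symbolMul_smul m 0 0
    rw [zero_smul, zero_smul] at h
    exact (memLp_congr_ae h).2 MemLp.zero
  add_mem' := by
    intro f g hf hg
    rw [Set.mem_ofPred_eq] at hf hg ⊢
    exact (memLp_congr_ae (symbolMul_add m f g)).2 (hf.add hg)
  smul_mem' := by
    intro c f hf
    rw [Set.mem_ofPred_eq] at hf ⊢
    exact (memLp_congr_ae (symbolMul_smul m c f)).2 (hf.const_smul c)

/-- The operator `T_m` in `L²(ℝ)`, with `(T_m f)^ = √m f̂`. -/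
def opT (m : ℝ → ℝ) : L2R →ₗ.[ℂ] L2R where
  domain := domT m
  toFun :=
    { toFun := fun f => 𝓕⁻ (MemLp.toLp (symbolMul m f.1) f.2 : L2R)
      map_add' := fun f g => by
        rw [← FourierTransform.fourierInv_add, ← MemLp.toLp_add f.2 g.2]
        congr 1
        exact MemLp.toLp_congr _ _ (symbolMul_add m f.1 g.1)
      map_smul' := fun c f => by
        rw [RingHom.id_apply, ← FourierTransform.fourierInv_smul,
          ← MemLp.toLp_const_smul c f.2]
        congr 1
        exact MemLp.toLp_congr _ _ (symbolMul_smul m c f.1) }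

/-- The function `1_{[0,t]}` in `L²(ℝ)`, which is `-1_{[t,0]}` for `t < 0`, so that
`∫ f 1_{[0,t]} = ∫_0^t f` for every real `t`. -/
def signedIndicator (t : ℝ) : L2R :=
  indicatorConstLp 2 (measurableSet_Icc (a := (0 : ℝ)) (b := t)) measure_Icc_lt_top.ne 1 -
    indicatorConstLp 2 (measurableSet_Icc (a := t) (b := (0 : ℝ))) measure_Icc_lt_top.ne 1

/-- The free process `X_m(t) = ℓ_{T_m 1_{[0,t]}} + ℓ_{T_m 1_{[0,t]}}^*`, a family of bounded
operators in `Γ(L²(ℝ)) = Γ(H_0)`, for an `m` such that all the functions `1_{[0,t]}` belong to the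
domain of `T_m`. -/
def freeProcess (m : ℝ → ℝ) (hm : ∀ t, signedIndicator t ∈ (opT m).domain) (t : ℝ) :
    FockH 0 →L[ℂ] FockH 0 :=
  freeField (hermiteWeight 0) (hermiteCoeff (opT m ⟨signedIndicator t, hm t⟩))

end FreeProc

end FreeNoise

end

/-! The vector `T_m 1_{[0,t]}` has a derivative in `t`, not in `L²(ℝ)` in general, but in some
`H_{-p}`; the field operator depends continuously on its vector in that larger space.

Vectors: by Plancherel (`inner_hermiteLp_opT`) the `n`-th Hermite coefficient of `T_m 1_{[0,t]}` is
the integral over `v` of the conjugate of `𝓕 hₙ(v)` times `√m(2πv)` times `∫_0^t e^{-2πixv} dx`. The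
difference quotients of the last factor have modulus at most 1 and tend to `e^{-2πitv}`. An
integrable majorant comes from `|𝓕 hₙ(v)| ≤ C (n+1)^{N+3} / (1 + |2πv|^{N+2})`
(`norm_fourier_hermiteC_le_div`), since `√m(u) / (1 + |u|^{N+2})` is integrable: it is
`O(|u|^{-b/2})` near 0 with `b/2 < 1`, and `O(u^{-2})` at infinity. So each coefficient converges,
dominated by a fixed multiple of `(n+1)^{N+3}`; this sequence lies in `H_{-p}` for `p = 2(N+3)+2`,
so the difference quotients converge in `H_{-p}` (`tendsto_weightedL2_of_dominated`).

Operators: for `c ∈ H_{-p}`, creation acts on `Γ(H_{-p}) ⊇ Γ(H_p)`, and annihilation pairs `c` with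
the first letter of an element of `Γ(H_p)`, by the duality of `H_{-p}` and `H_p`. Both have norm at
most `‖c‖`, so `dualField` is a bounded real-linear map into the operators from `Γ(H_p)` to
`Γ(H_{-p})`. It agrees with `X_m(t)` on test functions (`whiteNoise_freeField`). Composing with the
continuous inclusions of `S̃₁` into `Γ(H_p)` and of `Γ(H_{-p})` into `S̃₋₁` gives the limit. -/

noncomputable section

namespace FreeNoise

/-! ### Annihilation between Fock spaces with dual weights -/

section Annihilation

variable {ι : Type}

theorem wordWeight_pos (a : ι → ℝ) [Fact (∀ i, 0 < a i)] (w : List ι) : 0 < wordWeight a w :=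
  (inferInstance : Fact (∀ w, 0 < wordWeight a w)).out w

theorem wordWeight_cons (a : ι → ℝ) (i : ι) (w : List ι) :
    wordWeight a (i :: w) = a i * wordWeight a w := by
  simp [wordWeight]

variable (a b : ι → ℝ) [ha : Fact (∀ i, 0 < a i)] [hb : Fact (∀ i, 0 < b i)]

theorem coeff_creation (c : WeightedL2 a) (f : Fock a) :
    coeff (wordWeight a) (creation a c f) =
      tensorCoeff (coeff a c) (coeff (wordWeight a) f) := rfl

theorem norm_creation_apply (c : WeightedL2 a) (f : Fock a) :
    ‖creation a c f‖ = ‖c‖ * ‖f‖ := by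
  refine (sq_eq_sq₀ (norm_nonneg _) (by positivity)).1 ?_
  rw [norm_sq_eq, mul_pow]
  exact (hasSum_tensorCoeff a c f).tsum_eq

theorem summable_of_weight_le (h : ∀ i, a i ≤ b i) (f : WeightedL2 b) :
    Summable fun i => ‖coeff b f i‖ ^ 2 * a i :=
  Summable.of_nonneg_of_le (fun i => mul_nonneg (sq_nonneg _) (ha.out i).le)
    (fun i => mul_le_mul_of_nonneg_left (h i) (sq_nonneg _)) (summable_coeff b f)

/-- The inclusion of `ℓ²(ι, b)` into `ℓ²(ι, a)`, for `a ≤ b`. -/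
def weightedInclusion (h : ∀ i, a i ≤ b i) : WeightedL2 b →L[ℂ] WeightedL2 a :=
  LinearMap.mkContinuous
    { toFun := fun f => ofCoeff a (coeff b f) (summable_of_weight_le a b h f)
      map_add' := fun _ _ => rfl
      map_smul' := fun _ _ => rfl }
    1
    (fun f => by
      rw [one_mul]
      refine abs_le_of_sq_le_sq' ?_ (norm_nonneg _) |>.2
      rw [norm_sq_eq, norm_sq_eq]
      exact Summable.tsum_le_tsum
        (fun i => mul_le_mul_of_nonneg_left (h i) (sq_nonneg _))
        (summable_of_weight_le a b h f) (summable_coeff b f))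

theorem coeff_weightedInclusion (h : ∀ i, a i ≤ b i) (f : WeightedL2 b) :
    coeff a (weightedInclusion a b h f) = coeff b f :=
  coeff_ofCoeff a (coeff b f) (summable_of_weight_le a b h f)

theorem norm_weightedInclusion_le (h : ∀ i, a i ≤ b i) : ‖weightedInclusion a b h‖ ≤ 1 :=
  LinearMap.mkContinuous_norm_le _ zero_le_one _

/-- The pairing `∑ i, conj (c i) f i` of `ℓ²(ι, a)` and `ℓ²(ι, b)`, for `a b = 1`. -/
theorem hasSum_pairing (hab : ∀ i, a i * b i = 1) (c : WeightedL2 a) (f : WeightedL2 b) :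
    HasSum (fun i => starRingEnd ℂ (coeff a c i) * coeff b f i) ⟪scale a c, scale b f⟫_ℂ := by
  refine (lp.hasSum_inner (scale a c) (scale b f)).congr_fun fun i => ?_
  rw [scale_apply, scale_apply, RCLike.inner_apply, map_mul, Complex.conj_ofReal]
  have h : (Real.sqrt (a i) : ℂ) * (Real.sqrt (b i) : ℂ) = 1 := by
    rw [← Complex.ofReal_mul, ← Real.sqrt_mul (ha.out i).le, hab, Real.sqrt_one, Complex.ofReal_one]
  linear_combination (-(starRingEnd ℂ (coeff a c i) * coeff b f i)) * h

theorem summable_slice (f : Fock b) (w : List ι) :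
    Summable fun i => ‖coeff (wordWeight b) f (i :: w)‖ ^ 2 * b i := by
  have h := (summable_coeff (wordWeight b) f).comp_injective
    (i := fun i : ι => i :: w) (fun i j h => (List.cons.inj h).1)
  refine (h.mul_right (wordWeight b w)⁻¹).congr fun i => ?_
  have := (wordWeight_pos b w).ne'
  simp only [Function.comp_apply, wordWeight_cons]
  field_simp

/-- The family `i ↦ f (i w)`, for a word `w`. -/
def slice (w : List ι) : Fock b →ₗ[ℂ] WeightedL2 b where
  toFun f := ofCoeff b (fun i => coeff (wordWeight b) f (i :: w)) (summable_slice b f w)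
  map_add' _ _ := rfl
  map_smul' _ _ := rfl

theorem coeff_slice (f : Fock b) (w : List ι) (i : ι) :
    coeff b (slice b w f) i = coeff (wordWeight b) f (i :: w) := rfl

/-- Each nonempty word is uniquely a first letter followed by a tail, so this regroups the norm of
`f` by tails. It is only an inequality because the vacuum coefficient is lost. -/
theorem summable_norm_slice (f : Fock b) :
    (Summable fun w => ‖slice b w f‖ ^ 2 * wordWeight b w) ∧
      ∑' w, ‖slice b w f‖ ^ 2 * wordWeight b w ≤ ‖f‖ ^ 2 := by
  have hinj : Function.Injective (fun x : List ι × ι => x.2 :: x.1) := by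
    rintro ⟨w, i⟩ ⟨v, j⟩ h
    simp_all
  have hs := (summable_coeff (wordWeight b) f).comp_injective hinj
  have heq : ∀ w, ∑' i, ((fun v => ‖coeff (wordWeight b) f v‖ ^ 2 * wordWeight b v) ∘
      fun x : List ι × ι => x.2 :: x.1) (w, i) = ‖slice b w f‖ ^ 2 * wordWeight b w := by
    intro w
    rw [norm_sq_eq, ← tsum_mul_right]
    refine tsum_congr fun i => ?_
    simp only [Function.comp_apply, wordWeight_cons, coeff_slice]
    ring
  refine ⟨hs.prod.congr fun w => heq w, ?_⟩
  rw [← tsum_congr heq, ← hs.tsum_prod, norm_sq_eq]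
  exact tsum_comp_le_tsum_of_inj (summable_coeff (wordWeight b) f)
    (fun w => mul_nonneg (sq_nonneg _) (wordWeight_pos b w).le) hinj

/-- The coefficients of `ℓ_c^* f`. -/
def annihilationCoeff (c : WeightedL2 a) (f : Fock b) (w : List ι) : ℂ :=
  ⟪scale a c, scale b (slice b w f)⟫_ℂ

/-- Cauchy–Schwarz in the unweighted `ℓ²`, which needs no relation between `a` and `b`. The
condition `a b = 1` matters only for reading the inner product as `∑ conj (c i) f (i w)`. -/
theorem norm_annihilationCoeff_sq_le (c : WeightedL2 a) (f : Fock b) (w : List ι) :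
    ‖annihilationCoeff a b c f w‖ ^ 2 ≤ ‖c‖ ^ 2 * ‖slice b w f‖ ^ 2 := by
  rw [← mul_pow, ← norm_scale a, ← norm_scale b]
  exact pow_le_pow_left₀ (norm_nonneg _) (norm_inner_le_norm _ _) 2

variable (d : ι → ℝ) [hd : Fact (∀ i, 0 < d i)]

theorem annihilationCoeff_mul_le (hdb : ∀ w, wordWeight d w ≤ wordWeight b w)
    (c : WeightedL2 a) (f : Fock b) (w : List ι) :
    ‖annihilationCoeff a b c f w‖ ^ 2 * wordWeight d w ≤
      ‖c‖ ^ 2 * (‖slice b w f‖ ^ 2 * wordWeight b w) := by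
  rw [← mul_assoc]
  exact mul_le_mul (norm_annihilationCoeff_sq_le a b c f w) (hdb w) (wordWeight_pos d w).le
    (by positivity)

theorem summable_annihilationCoeff (hdb : ∀ w, wordWeight d w ≤ wordWeight b w)
    (c : WeightedL2 a) (f : Fock b) :
    Summable fun w => ‖annihilationCoeff a b c f w‖ ^ 2 * wordWeight d w :=
  Summable.of_nonneg_of_le (fun w => mul_nonneg (sq_nonneg _) (wordWeight_pos d w).le)
    (annihilationCoeff_mul_le a b d hdb c f) ((summable_norm_slice b f).1.mul_left _)

/-- The annihilation operator `ℓ_c^*` from the Fock space of `ℓ²(ι, b)` to the one of `ℓ²(ι, d)`,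
for `c` in the dual `ℓ²(ι, a)` of `ℓ²(ι, b)`. -/
def annihilation (hdb : ∀ w, wordWeight d w ≤ wordWeight b w) (c : WeightedL2 a) :
    Fock b →L[ℂ] Fock d :=
  LinearMap.mkContinuous
    { toFun := fun f => ofCoeff (wordWeight d) (annihilationCoeff a b c f)
        (summable_annihilationCoeff a b d hdb c f)
      map_add' := fun f g => by
        refine coeff_injective (wordWeight d) (funext fun w => ?_)
        rw [map_add, coeff_ofCoeff, coeff_ofCoeff, coeff_ofCoeff]
        simp only [annihilationCoeff, map_add, inner_add_right, Pi.add_apply]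
      map_smul' := fun r f => by
        refine coeff_injective (wordWeight d) (funext fun w => ?_)
        rw [map_smul, coeff_ofCoeff, coeff_ofCoeff]
        simp only [annihilationCoeff, map_smul, inner_smul_right, Pi.smul_apply, smul_eq_mul,
          RingHom.id_apply] }
    ‖c‖
    (fun f => by
      refine abs_le_of_sq_le_sq' ?_ (by positivity) |>.2
      rw [norm_sq_eq, mul_pow]
      refine ((summable_annihilationCoeff a b d hdb c f).tsum_le_tsum
        (annihilationCoeff_mul_le a b d hdb c f)
        ((summable_norm_slice b f).1.mul_left _)).trans ?_
      rw [tsum_mul_left]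
      exact mul_le_mul_of_nonneg_left (summable_norm_slice b f).2 (sq_nonneg _))

theorem coeff_annihilation (hdb : ∀ w, wordWeight d w ≤ wordWeight b w) (c : WeightedL2 a)
    (f : Fock b) (w : List ι) :
    coeff (wordWeight d) (annihilation a b d hdb c f) w = annihilationCoeff a b c f w := rfl

theorem norm_annihilation_le (hdb : ∀ w, wordWeight d w ≤ wordWeight b w) (c : WeightedL2 a) :
    ‖annihilation a b d hdb c‖ ≤ ‖c‖ :=
  LinearMap.mkContinuous_norm_le _ (norm_nonneg _) _

/-- The basis vector of the word `w`. -/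
def single [DecidableEq ι] (w : List ι) : Fock a :=
  ofCoeff (wordWeight a) (Pi.single w 1)
    (summable_of_ne_finset_zero (s := {w}) fun v hv => by
      rw [Finset.notMem_singleton] at hv
      simp [hv])

theorem coeff_single [DecidableEq ι] (w : List ι) :
    coeff (wordWeight a) (single a w) = Pi.single w 1 := rfl

theorem inner_eq_tsum (f g : WeightedL2 a) :
    ⟪f, g⟫_ℂ = ∑' i, starRingEnd ℂ (coeff a f i) * coeff a g i * a i := by
  change ⟪scale a f, scale a g⟫_ℂ = _
  rw [lp.inner_eq_tsum]
  refine tsum_congr fun i => ?_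
  rw [scale_apply, scale_apply, RCLike.inner_apply, map_mul, Complex.conj_ofReal]
  have h : (Real.sqrt (a i) : ℂ) * (Real.sqrt (a i) : ℂ) = a i := by
    rw [← Complex.ofReal_mul, Real.mul_self_sqrt (ha.out i).le]
  linear_combination (starRingEnd ℂ (coeff a f i) * coeff a g i) * h

theorem inner_single [DecidableEq ι] (w : List ι) (f : Fock a) :
    ⟪single a w, f⟫_ℂ = coeff (wordWeight a) f w * wordWeight a w := by
  rw [inner_eq_tsum, tsum_eq_single w]
  · simp [coeff_single]
  · intro v hv
    simp [coeff_single, hv]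

/-- The hypothesis is the self-dual case of the pairing and forces `a = 1`; it covers `H_0`. The
adjoint is computed by testing against basis vectors, which for unit weights are orthonormal. -/
theorem adjoint_creation_eq_annihilation [DecidableEq ι] (haa : ∀ i, a i * a i = 1)
    (c : WeightedL2 a) :
    ContinuousLinearMap.adjoint (creation a c) = annihilation a a a (fun _ => le_rfl) c := by
  ext f
  refine coeff_injective (wordWeight a) (funext fun w => ?_)
  have ha1 : ∀ i, a i = 1 := fun i => by nlinarith [haa i, ha.out i]
  have hw1 : ∀ w, wordWeight a w = 1 := fun w => by
    rw [wordWeight, List.prod_eq_one]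
    intro x hx
    obtain ⟨i, _, rfl⟩ := List.mem_map.1 hx
    exact ha1 i
  have h1 := inner_single a w (ContinuousLinearMap.adjoint (creation a c) f)
  rw [hw1, Complex.ofReal_one, mul_one] at h1
  rw [← h1, ContinuousLinearMap.adjoint_inner_right, inner_eq_tsum, coeff_annihilation,
    annihilationCoeff, ← (hasSum_pairing a a haa c (slice a w f)).tsum_eq]
  -- The vector `c ⊗ e_w` is supported on the words `i w`, so the sum over all words reduces to one
  -- over the first letter.
  have hinj : Function.Injective (fun i : ι => i :: w) := fun i j h => (List.cons.inj h).1
  rw [← hinj.tsum_eq]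
  · refine tsum_congr fun i => ?_
    simp [coeff_creation, coeff_single, tensorCoeff, hw1, coeff_slice]
  · intro v hv
    cases v with
    | nil => simp [coeff_creation, tensorCoeff] at hv
    | cons i v =>
      by_cases h : v = w
      · exact ⟨i, by rw [h]⟩
      · simp [coeff_creation, tensorCoeff, coeff_single, h] at hv

end Annihilation

/-! ### Topologies of the Kondratiev spaces -/

section Kondratiev

theorem continuous_testToFock (p : ℕ) : Continuous (testToFock p) :=
  continuous_iff_le_induced.2 (iInf_le _ p)

/-- The one property of the inductive limit topology that the limit needs: convergence takes place
in a single `Γ(H_{-p})` and is then pushed forward. -/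
theorem continuous_fockToDistribution (p : ℕ) : Continuous (fockToDistribution p) :=
  continuous_sInf_rng.2 fun _ ht => ht.2.2.2 p

theorem neg_natCast_le (p : ℕ) : (-(p : ℤ)) ≤ p := by omega

theorem coeff_testToFock (p : ℕ) (f : TestSpace) :
    coeff (wordWeight (hermiteWeight p)) (testToFock p f) = f.1 := rfl

theorem coeff_testToWhiteNoise (f : TestSpace) :
    coeff (wordWeight (hermiteWeight 0)) (testToWhiteNoise f) = f.1 := rfl

theorem val_fockToDistribution (p : ℕ) (f : FockH (-(p : ℤ))) :
    (fockToDistribution p f).1 = coeff (wordWeight (hermiteWeight (-(p : ℤ)))) f := rfl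

theorem val_whiteNoiseToDistribution (f : FockH 0) :
    (whiteNoiseToDistribution f).1 = coeff (wordWeight (hermiteWeight 0)) f := rfl

/-- The inclusion of `Γ(H_p)` into `Γ(H_{-p})`. -/
def fockInclusion (p : ℕ) : FockH p →L[ℂ] FockH (-(p : ℤ)) :=
  weightedInclusion (wordWeight (hermiteWeight (-(p : ℤ)))) (wordWeight (hermiteWeight p))
    (wordWeight_mono (neg_natCast_le p))

theorem coeff_fockInclusion (p : ℕ) (f : FockH p) :
    coeff (wordWeight (hermiteWeight (-(p : ℤ)))) (fockInclusion p f) =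
      coeff (wordWeight (hermiteWeight p)) f := coeff_weightedInclusion _ _ _ f

theorem norm_fockInclusion_le (p : ℕ) : ‖fockInclusion p‖ ≤ 1 :=
  norm_weightedInclusion_le _ _ _

theorem hermiteWeight_neg_mul (p : ℤ) (n : ℕ) : hermiteWeight (-p) n * hermiteWeight p n = 1 := by
  unfold hermiteWeight
  rw [← zpow_add₀ (by positivity)]
  simp

/-- The operator `ℓ_c + ℓ_c^*` from `Γ(H_p)` to `Γ(H_{-p})`, for `c` in `H_{-p}`. -/
def dualField (p : ℕ) : HermiteSpace (-(p : ℤ)) →L[ℝ] (FockH p →L[ℂ] FockH (-(p : ℤ))) :=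
  LinearMap.mkContinuous
    { toFun := fun c => (creation (hermiteWeight (-(p : ℤ))) c).comp (fockInclusion p) +
        annihilation (hermiteWeight (-(p : ℤ))) (hermiteWeight p) (hermiteWeight (-(p : ℤ)))
          (wordWeight_mono (neg_natCast_le p)) c
      map_add' := fun c c' => by
        ext f
        refine coeff_injective (wordWeight (hermiteWeight (-(p : ℤ)))) (funext fun w => ?_)
        simp only [add_apply, ContinuousLinearMap.comp_apply, map_add,
          coeff_creation, Pi.add_apply, coeff_annihilation, annihilationCoeff, inner_add_left]
        cases w <;> simp only [tensorCoeff, Pi.add_apply] <;> ring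
      map_smul' := fun r c => by
        ext f
        refine coeff_injective (wordWeight (hermiteWeight (-(p : ℤ)))) (funext fun w => ?_)
        -- Annihilation is conjugate linear in `c`, so the sum with creation is linear over `ℝ`
        -- only: a real scalar equals its conjugate.
        rw [← Complex.coe_smul, ← Complex.coe_smul]
        simp only [add_apply, ContinuousLinearMap.comp_apply, map_add, map_smul,
          coeff_creation, Pi.add_apply, coeff_annihilation, annihilationCoeff, inner_smul_left,
          RingHom.id_apply, smul_apply, Pi.smul_apply, smul_eq_mul,
          Complex.conj_ofReal]
        cases w <;> simp only [tensorCoeff, Pi.smul_apply, smul_eq_mul] <;> ring }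
    2
    (fun c => by
      refine (norm_add_le _ _).trans ?_
      have h1 : ‖(creation (hermiteWeight (-(p : ℤ))) c).comp (fockInclusion p)‖ ≤ ‖c‖ := by
        refine (ContinuousLinearMap.opNorm_comp_le _ _).trans ?_
        refine (mul_le_mul (ContinuousLinearMap.opNorm_le_bound _ (norm_nonneg c) fun f =>
          (norm_creation_apply _ c f).le) (norm_fockInclusion_le p) (norm_nonneg _)
          (norm_nonneg _)).trans (mul_one _).le
      have h2 := norm_annihilation_le (hermiteWeight (-(p : ℤ))) (hermiteWeight p)
        (hermiteWeight (-(p : ℤ))) (wordWeight_mono (neg_natCast_le p)) c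
      linarith)

theorem dualField_apply (p : ℕ) (c : HermiteSpace (-(p : ℤ))) :
    dualField p c = (creation (hermiteWeight (-(p : ℤ))) c).comp (fockInclusion p) +
      annihilation (hermiteWeight (-(p : ℤ))) (hermiteWeight p) (hermiteWeight (-(p : ℤ)))
        (wordWeight_mono (neg_natCast_le p)) c := rfl

/-- The operator `ℓ_c + ℓ_c^*` from `S̃₁` to `S̃₋₁`, for `c` in `H_{-p}`. -/
def distributionField (p : ℕ) (c : HermiteSpace (-(p : ℤ))) : TestSpace →L[ℂ] DistributionSpace where
  toLinearMap := fockToDistribution p ∘ₗ (dualField p c).toLinearMap ∘ₗ testToFock p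
  cont := (continuous_fockToDistribution p).comp
    ((dualField p c).continuous.comp (continuous_testToFock p))

theorem distributionField_apply (p : ℕ) (c : HermiteSpace (-(p : ℤ))) (f : TestSpace) :
    distributionField p c f = fockToDistribution p (dualField p c (testToFock p f)) := rfl

theorem tendsto_distributionField {α : Type*} {l : Filter α} (p : ℕ)
    {c : α → HermiteSpace (-(p : ℤ))} {c₀ : HermiteSpace (-(p : ℤ))} (h : Tendsto c l (𝓝 c₀))
    (f : TestSpace) :
    Tendsto (fun x => distributionField p (c x) f) l (𝓝 (distributionField p c₀ f)) := by
  have h1 : Tendsto (fun x => dualField p (c x) (testToFock p f)) l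
      (𝓝 (dualField p c₀ (testToFock p f))) :=
    ((dualField p).continuous.clm_apply continuous_const).continuousAt.tendsto.comp h
  exact (continuous_fockToDistribution p).continuousAt.tendsto.comp h1

theorem distributionField_sub (p : ℕ) (c c' : HermiteSpace (-(p : ℤ))) (f : TestSpace) :
    distributionField p (c - c') f = distributionField p c f - distributionField p c' f := by
  simp only [distributionField_apply, map_sub, sub_apply]

theorem distributionField_smul (p : ℕ) (r : ℝ) (c : HermiteSpace (-(p : ℤ))) (f : TestSpace) :
    distributionField p (r • c) f = r • distributionField p c f := by
  simp only [distributionField_apply, map_smul, smul_apply]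
  rw [← Complex.coe_smul, ← Complex.coe_smul, map_smul]

/-- The pairing `∑ conj (c i) f (i w)` does not involve the weights, so the Hilbert space adjoint
over `H_0` and the annihilation operator by duality have the same coefficients. -/
theorem whiteNoise_freeField (p : ℕ) (c : HermiteSpace 0) (c' : HermiteSpace (-(p : ℤ)))
    (hc : coeff (hermiteWeight (-(p : ℤ))) c' = coeff (hermiteWeight 0) c) (f : TestSpace) :
    whiteNoiseToDistribution (freeField (hermiteWeight 0) c (testToWhiteNoise f)) =
      distributionField p c' f := by
  have h0 : ∀ i, hermiteWeight 0 i * hermiteWeight 0 i = 1 := fun i => by simp [hermiteWeight]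
  refine Subtype.ext ?_
  rw [val_whiteNoiseToDistribution, distributionField_apply, val_fockToDistribution, dualField_apply,
    freeField, adjoint_creation_eq_annihilation _ h0, add_apply, add_apply, map_add, map_add,
    ContinuousLinearMap.comp_apply, coeff_creation, coeff_creation, hc, coeff_fockInclusion,
    coeff_testToFock, coeff_testToWhiteNoise]
  congr 1
  funext w
  rw [coeff_annihilation, coeff_annihilation, annihilationCoeff, annihilationCoeff,
    ← (hasSum_pairing _ _ h0 c _).tsum_eq,
    ← (hasSum_pairing _ _ (hermiteWeight_neg_mul p) c' _).tsum_eq, hc]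
  simp only [coeff_slice, coeff_testToFock, coeff_testToWhiteNoise]

end Kondratiev

/-! ### Recurrences and integral bounds for the Hermite functions -/

section HermiteBounds

open Polynomial

theorem derivative_hermiteR_succ (n : ℕ) :
    derivative (hermiteR (n + 1)) = ((n : ℝ) + 1) • hermiteR n := by
  induction n with
  | zero => simp [hermiteR]
  | succ n ih =>
    rw [hermiteR_succ (n + 1), derivative_sub, derivative_mul, ih, derivative_smul, hermiteR_succ n]
    simp only [derivative_X, smul_eq_C_mul, Nat.cast_add, Nat.cast_one, C_add]
    simp only [map_one]
    ring

/-- The truncated index `n - 1` is harmless at `n = 0`, where the factor `n` vanishes; the same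
holds for the factors `√n` below. -/
theorem derivative_hermiteR (n : ℕ) :
    derivative (hermiteR n) = (n : ℝ) • hermiteR (n - 1) := by
  cases n with
  | zero => simp [hermiteR]
  | succ n => rw [derivative_hermiteR_succ]; simp

theorem hermiteFun_eq (n : ℕ) (u : ℝ) :
    hermiteFun n u = (hermiteR n).eval (Real.sqrt 2 * u) * Real.exp (-u ^ 2 / 2) /
      (Real.pi ^ (1 / 4 : ℝ) * Real.sqrt n.factorial) := by
  simp [hermiteFun, hermiteR, aeval_def, eval_map]

theorem sqrt_factorial_succ (n : ℕ) :
    Real.sqrt ((n + 1).factorial : ℝ) = Real.sqrt (n + 1) * Real.sqrt (n.factorial : ℝ) := by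
  rw [Nat.factorial_succ, Nat.cast_mul, Real.sqrt_mul (by positivity)]
  simp

theorem sqrt_two_mul_mul_hermiteFun (n : ℕ) (u : ℝ) :
    Real.sqrt 2 * u * hermiteFun n u =
      Real.sqrt (n + 1) * hermiteFun (n + 1) u + Real.sqrt n * hermiteFun (n - 1) u := by
  have hp : (0 : ℝ) < Real.pi ^ (1 / 4 : ℝ) := Real.rpow_pos_of_pos Real.pi_pos _
  have hf : 0 < Real.sqrt (n.factorial : ℝ) := Real.sqrt_pos.2 (by positivity)
  have h1 : (0 : ℝ) < Real.sqrt (n + 1) := Real.sqrt_pos.2 (by positivity)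
  have e := congrArg (fun P => P.eval (Real.sqrt 2 * u)) (hermiteR_succ n)
  simp only [derivative_hermiteR, eval_sub, eval_mul, eval_X, eval_smul, smul_eq_mul] at e
  simp only [hermiteFun_eq, sqrt_factorial_succ]
  cases n with
  | zero =>
    simp only [CharP.cast_eq_zero, zero_mul, sub_zero] at e
    rw [e]
    simp
    field_simp
  | succ n =>
    have hf : 0 < Real.sqrt (n.factorial : ℝ) := Real.sqrt_pos.2 (by positivity)
    have h2 : (0 : ℝ) < Real.sqrt (n + 1) := Real.sqrt_pos.2 (by positivity)
    have h3 : Real.sqrt ((n : ℝ) + 1) * Real.sqrt (n + 1) = n + 1 :=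
      Real.mul_self_sqrt (by positivity)
    simp only [Nat.add_sub_cancel, Nat.cast_add, Nat.cast_one, sqrt_factorial_succ] at e h1 ⊢
    rw [e]
    field_simp
    linear_combination (-eval (Real.sqrt 2 * u) (hermiteR n)) * h3

/-- Differentiating the polynomial lowers the degree and the Gaussian contributes `-u hₙ(u)`; the
three-term recurrence then eliminates `u hₙ(u)`. -/
theorem hasDerivAt_hermiteFun (n : ℕ) (u : ℝ) :
    HasDerivAt (hermiteFun n)
      ((Real.sqrt n * hermiteFun (n - 1) u - Real.sqrt (n + 1) * hermiteFun (n + 1) u) /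
        Real.sqrt 2) u := by
  have hp : (0 : ℝ) < Real.pi ^ (1 / 4 : ℝ) := Real.rpow_pos_of_pos Real.pi_pos _
  have hf : 0 < Real.sqrt (n.factorial : ℝ) := Real.sqrt_pos.2 (by positivity)
  have h2 : (0 : ℝ) < Real.sqrt 2 := by positivity
  have h22 : Real.sqrt 2 * Real.sqrt 2 = 2 := Real.mul_self_sqrt (by norm_num)
  have hd : HasDerivAt (hermiteFun n)
      (Real.sqrt 2 * ((n : ℝ) * (hermiteR (n - 1)).eval (Real.sqrt 2 * u)) *
        Real.exp (-u ^ 2 / 2) / (Real.pi ^ (1 / 4 : ℝ) * Real.sqrt n.factorial) -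
        u * hermiteFun n u) u := by
    have a1 : HasDerivAt (fun u : ℝ => Real.sqrt 2 * u) (Real.sqrt 2) u := by
      simpa using (hasDerivAt_id u).const_mul (Real.sqrt 2)
    have a2 := ((hermiteR n).hasDerivAt (Real.sqrt 2 * u)).comp u a1
    have a3 : HasDerivAt (fun u : ℝ => Real.exp (-u ^ 2 / 2)) (Real.exp (-u ^ 2 / 2) * (-u)) u := by
      have := (((hasDerivAt_pow 2 u).neg).div_const 2).exp
      refine this.congr_deriv ?_
      simp
      ring
    have a4 := (a2.mul a3).div_const (Real.pi ^ (1 / 4 : ℝ) * Real.sqrt n.factorial)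
    refine (a4.congr_of_eventuallyEq (Eventually.of_forall fun x => hermiteFun_eq n x)).congr_deriv ?_
    rw [hermiteFun_eq, derivative_hermiteR, eval_smul, smul_eq_mul]
    simp only [Function.comp_apply]
    ring
  refine hd.congr_deriv ?_
  have hn : (n : ℝ) * (hermiteR (n - 1)).eval (Real.sqrt 2 * u) *
        Real.exp (-u ^ 2 / 2) / (Real.pi ^ (1 / 4 : ℝ) * Real.sqrt n.factorial) =
      Real.sqrt n * hermiteFun (n - 1) u := by
    cases n with
    | zero => simp
    | succ n =>
      have hf : 0 < Real.sqrt (n.factorial : ℝ) := Real.sqrt_pos.2 (by positivity)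
      have h2 : (0 : ℝ) < Real.sqrt (n + 1) := Real.sqrt_pos.2 (by positivity)
      have h3 : Real.sqrt ((n : ℝ) + 1) ^ 2 = n + 1 := Real.sq_sqrt (by positivity)
      simp only [hermiteFun_eq, Nat.add_sub_cancel, Nat.cast_add, Nat.cast_one, sqrt_factorial_succ]
      field_simp
      rw [h3]
      ring
  have hr := sqrt_two_mul_mul_hermiteFun n u
  rw [eq_div_iff h2.ne']
  linear_combination 2 * hn - hr + (n : ℝ) * (hermiteR (n - 1)).eval (Real.sqrt 2 * u) *
        Real.exp (-u ^ 2 / 2) / (Real.pi ^ (1 / 4 : ℝ) * Real.sqrt n.factorial) * h22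

theorem integrable_sq_hermiteFun (n : ℕ) : Integrable fun u => hermiteFun n u ^ 2 := by
  simpa [sq] using integrable_hermiteFun_mul n n

theorem integral_sq_hermiteFun (n : ℕ) : ∫ u, hermiteFun n u ^ 2 = 1 := by
  simpa [sq] using integral_hermiteFun_mul n n

/-- A majorant of `|hₙ|` whose integral grows linearly in `n`. -/
def hermiteMajorant (n : ℕ) (u : ℝ) : ℝ :=
  (1 + u ^ 2)⁻¹ + hermiteFun n u ^ 2 + ((n : ℝ) + 1) * hermiteFun (n + 1) u ^ 2 +
    (n : ℝ) * hermiteFun (n - 1) u ^ 2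

/-- Apply `x ≤ w⁻¹ + w x²` with `w = 1 + u²`, then bound `(u hₙ)²` by the three-term recurrence and
`(x + y)² ≤ 2(x² + y²)`. This turns the `L²` normalisation into an `L¹` bound. -/
theorem abs_hermiteFun_le (n : ℕ) (u : ℝ) : |hermiteFun n u| ≤ hermiteMajorant n u := by
  have h22 : Real.sqrt 2 ^ 2 = 2 := Real.sq_sqrt (by norm_num)
  have e : 2 * (u * hermiteFun n u) ^ 2 = (Real.sqrt (n + 1) * hermiteFun (n + 1) u +
      Real.sqrt n * hermiteFun (n - 1) u) ^ 2 := by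
    rw [← sqrt_two_mul_mul_hermiteFun]
    linear_combination (-(u * hermiteFun n u) ^ 2) * h22
  have h1 : (u * hermiteFun n u) ^ 2 ≤ ((n : ℝ) + 1) * hermiteFun (n + 1) u ^ 2 +
      (n : ℝ) * hermiteFun (n - 1) u ^ 2 := by
    have e1 : Real.sqrt ((n : ℝ) + 1) ^ 2 = n + 1 := Real.sq_sqrt (by positivity)
    have e2 : Real.sqrt (n : ℝ) ^ 2 = n := Real.sq_sqrt (by positivity)
    have := sq_nonneg (Real.sqrt ((n : ℝ) + 1) * hermiteFun (n + 1) u -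
      Real.sqrt n * hermiteFun (n - 1) u)
    nlinarith
  have h2 : |hermiteFun n u| ≤ (1 + u ^ 2)⁻¹ + (1 + u ^ 2) * hermiteFun n u ^ 2 := by
    have hu : 0 < 1 + u ^ 2 := by positivity
    rw [← sq_abs (hermiteFun n u)]
    have h3 : (1 + u ^ 2)⁻¹ + (1 + u ^ 2) * |hermiteFun n u| ^ 2 - |hermiteFun n u| =
        (1 + u ^ 2)⁻¹ * (((1 + u ^ 2) * |hermiteFun n u| - 1 / 2) ^ 2 + 3 / 4) := by
      field_simp
      ring
    have : 0 ≤ (1 + u ^ 2)⁻¹ * (((1 + u ^ 2) * |hermiteFun n u| - 1 / 2) ^ 2 + 3 / 4) := by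
      positivity
    linarith
  unfold hermiteMajorant
  nlinarith

theorem integrable_hermiteMajorant (n : ℕ) : Integrable (hermiteMajorant n) :=
  ((integrable_inv_one_add_sq.add (integrable_sq_hermiteFun n)).add
    ((integrable_sq_hermiteFun (n + 1)).const_mul _)).add
    ((integrable_sq_hermiteFun (n - 1)).const_mul _)

theorem integral_hermiteMajorant (n : ℕ) : ∫ u, hermiteMajorant n u = Real.pi + 2 * (n + 1) := by
  have h2 : Integrable fun u : ℝ => (1 + u ^ 2)⁻¹ + hermiteFun n u ^ 2 :=
    integrable_inv_one_add_sq.add (integrable_sq_hermiteFun n)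
  have h3 : Integrable fun u : ℝ => (1 + u ^ 2)⁻¹ + hermiteFun n u ^ 2 +
      ((n : ℝ) + 1) * hermiteFun (n + 1) u ^ 2 :=
    h2.add ((integrable_sq_hermiteFun (n + 1)).const_mul _)
  unfold hermiteMajorant
  rw [integral_add h3 ((integrable_sq_hermiteFun (n - 1)).const_mul _),
    integral_add h2 ((integrable_sq_hermiteFun (n + 1)).const_mul _),
    integral_add integrable_inv_one_add_sq (integrable_sq_hermiteFun n), integral_const_mul,
    integral_const_mul, integral_sq_hermiteFun, integral_sq_hermiteFun, integral_sq_hermiteFun,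
    integral_univ_inv_one_add_sq]
  ring

theorem integrable_hermiteFun (n : ℕ) : Integrable (hermiteFun n) :=
  (integrable_hermiteMajorant n).mono' (continuous_hermiteFun n).aestronglyMeasurable
    (ae_of_all _ fun u => by simpa using abs_hermiteFun_le n u)

/-- The Hermite functions with complex values. -/
def hermiteC (n : ℕ) (u : ℝ) : ℂ := hermiteFun n u

theorem integrable_hermiteC (n : ℕ) : Integrable (hermiteC n) := (integrable_hermiteFun n).ofReal

theorem norm_fourier_hermiteC_le (n : ℕ) (v : ℝ) : ‖𝓕 (hermiteC n) v‖ ≤ 6 * (n + 1) := by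
  calc ‖𝓕 (hermiteC n) v‖ ≤ ∫ u, ‖hermiteC n u‖ :=
        VectorFourier.norm_fourierIntegral_le_integral_norm _ _ _ _ _
    _ ≤ ∫ u, hermiteMajorant n u := by
        refine integral_mono (integrable_hermiteC n).norm (integrable_hermiteMajorant n) fun u => ?_
        simpa [hermiteC] using abs_hermiteFun_le n u
    _ ≤ 6 * (n + 1) := by
        rw [integral_hermiteMajorant]
        have : (0 : ℝ) ≤ n := n.cast_nonneg
        linarith [Real.pi_le_four]

theorem hasDerivAt_hermiteC (n : ℕ) (u : ℝ) :
    HasDerivAt (hermiteC n)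
      (((Real.sqrt n / Real.sqrt 2 : ℝ) : ℂ) * hermiteC (n - 1) u -
        ((Real.sqrt (n + 1) / Real.sqrt 2 : ℝ) : ℂ) * hermiteC (n + 1) u) u := by
  refine (hasDerivAt_hermiteFun n u).ofReal_comp.congr_deriv ?_
  simp only [hermiteC]
  push_cast
  ring

/-- Multiplication by `2πiv` is differentiation before the transform, and a derivative of `hₙ` only
shifts `n` by one. Decay in `v` is thus traded for growth in `n`. -/
theorem fourier_hermiteC_recurrence (n : ℕ) (v : ℝ) :
    (2 * Real.pi * Complex.I * v) * 𝓕 (hermiteC n) v =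
      ((Real.sqrt n / Real.sqrt 2 : ℝ) : ℂ) * 𝓕 (hermiteC (n - 1)) v -
        ((Real.sqrt (n + 1) / Real.sqrt 2 : ℝ) : ℂ) * 𝓕 (hermiteC (n + 1)) v := by
  have hd : deriv (hermiteC n) = ((Real.sqrt n / Real.sqrt 2 : ℝ) : ℂ) • hermiteC (n - 1) -
        ((Real.sqrt (n + 1) / Real.sqrt 2 : ℝ) : ℂ) • hermiteC (n + 1) :=
    funext fun u => (hasDerivAt_hermiteC n u).deriv
  have hi : Integrable (deriv (hermiteC n)) := by
    rw [hd]
    exact ((integrable_hermiteC _).smul _).sub ((integrable_hermiteC _).smul _)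
  have h := congrFun (Real.fourier_deriv (integrable_hermiteC n)
    (fun u => (hasDerivAt_hermiteC n u).differentiableAt) hi) v
  rw [smul_eq_mul] at h
  rw [← h, hd]
  simp only [Real.fourier_eq, Pi.sub_apply, Pi.smul_apply, smul_sub]
  rw [integral_sub]
  · simp only [smul_comm _ ((_ : ℝ) : ℂ)]
    rw [integral_smul, integral_smul]
    rfl
  · exact (Real.fourierIntegral_convergent_iff v).2
      ((integrable_hermiteC (n - 1)).smul (((Real.sqrt n / Real.sqrt 2 : ℝ)) : ℂ))
  · exact (Real.fourierIntegral_convergent_iff v).2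
      ((integrable_hermiteC (n + 1)).smul (((Real.sqrt (n + 1) / Real.sqrt 2 : ℝ)) : ℂ))

theorem norm_fourier_hermiteC_mul_pow_le (k : ℕ) : ∃ C : ℝ, 0 ≤ C ∧ ∀ (n : ℕ) (v : ℝ),
    |2 * Real.pi * v| ^ k * ‖𝓕 (hermiteC n) v‖ ≤ C * ((n : ℝ) + 1) ^ (k + 1) := by
  induction k with
  | zero => exact ⟨6, by norm_num, fun n v => by simpa using norm_fourier_hermiteC_le n v⟩
  | succ k ih =>
    obtain ⟨C, hC, h⟩ := ih
    -- The 1 comes from the index `n - 1`, and `2 ^ (k + 1)` from the index `n + 1` through `n + 2 ≤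
    -- 2(n + 1)`.
    refine ⟨C * (1 + 2 ^ (k + 1)), by positivity, fun n v => ?_⟩
    have hn : (0 : ℝ) ≤ n := n.cast_nonneg
    have hc : ∀ x : ℝ, 0 ≤ x → x ≤ n + 1 → Real.sqrt x / Real.sqrt 2 ≤ n + 1 := fun x hx hxn => by
      rw [← Real.sqrt_div hx, Real.sqrt_le_left (by positivity)]
      nlinarith
    have e : |2 * Real.pi * v| ^ (k + 1) * ‖𝓕 (hermiteC n) v‖ =
        |2 * Real.pi * v| ^ k * ‖(2 * Real.pi * Complex.I * v) * 𝓕 (hermiteC n) v‖ := by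
      rw [norm_mul]
      simp [abs_mul]
      ring
    rw [e, fourier_hermiteC_recurrence]
    have h1 := (norm_sub_le (((Real.sqrt n / Real.sqrt 2 : ℝ) : ℂ) * 𝓕 (hermiteC (n - 1)) v)
        (((Real.sqrt (n + 1) / Real.sqrt 2 : ℝ) : ℂ) * 𝓕 (hermiteC (n + 1)) v))
    rw [norm_mul, norm_mul, Complex.norm_real, Complex.norm_real, Real.norm_of_nonneg (by positivity),
      Real.norm_of_nonneg (by positivity)] at h1
    have h2 := mul_le_mul_of_nonneg_left h1 (by positivity : 0 ≤ |2 * Real.pi * v| ^ k)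
    refine h2.trans ?_
    have h3 : |2 * Real.pi * v| ^ k * ‖𝓕 (hermiteC (n - 1)) v‖ ≤ C * ((n : ℝ) + 1) ^ (k + 1) := by
      refine (h (n - 1) v).trans ?_
      gcongr
      exact_mod_cast Nat.sub_le n 1
    have h4 : |2 * Real.pi * v| ^ k * ‖𝓕 (hermiteC (n + 1)) v‖ ≤
        C * (2 ^ (k + 1) * ((n : ℝ) + 1) ^ (k + 1)) := by
      refine (h (n + 1) v).trans ?_
      rw [← mul_pow]
      gcongr
      push_cast
      linarith
    have h5 := mul_le_mul (hc n hn (by linarith)) h3 (by positivity) (by positivity)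
    have h6 := mul_le_mul (hc (n + 1) (by positivity) le_rfl) h4 (by positivity) (by positivity)
    calc _ = Real.sqrt n / Real.sqrt 2 * (|2 * Real.pi * v| ^ k * ‖𝓕 (hermiteC (n - 1)) v‖) +
          Real.sqrt (n + 1) / Real.sqrt 2 *
            (|2 * Real.pi * v| ^ k * ‖𝓕 (hermiteC (n + 1)) v‖) := by ring
      _ ≤ _ := add_le_add h5 h6
      _ = _ := by ring

end HermiteBounds

/-! ### The Fourier transform on `L¹ ∩ L²` -/

section FourierL2

open scoped SchwartzMap ContDiff

theorem continuous_fourier_of_integrable {f : ℝ → ℂ} (hf : Integrable f) : Continuous (𝓕 f) :=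
  VectorFourier.fourierIntegral_continuous Real.continuous_fourierChar continuous_inner hf

/-- On `L¹ ∩ L²` the Fourier transform of `L²` is given by the Fourier integral. -/
theorem fourier_toLp_ae_eq {f : ℝ → ℂ} (h1 : Integrable f) (h2 : MemLp f 2) :
    (𝓕 (h2.toLp f : L2R) : L2R) =ᵐ[volume] 𝓕 f := by
  have hcont : Continuous (𝓕 f) := continuous_fourier_of_integrable h1
  -- Both sides are locally integrable, so testing against smooth compactly supported functions
  -- suffices. These are Schwartz functions, on which the `L²` transform is given by duality.
  refine ae_eq_of_integral_contDiff_smul_eq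
    ((Lp.memLp (𝓕 (h2.toLp f : L2R) : L2R)).locallyIntegrable (by norm_num))
    hcont.locallyIntegrable fun g g_smooth g_cpt => ?_
  have hg₁ : HasCompactSupport (Complex.ofRealCLM ∘ g) := g_cpt.comp_left rfl
  have hg₂ : ContDiff ℝ ∞ (Complex.ofRealCLM ∘ g) := by fun_prop
  set φ : 𝓢(ℝ, ℂ) := hg₁.toSchwartzMap hg₂ with hφ
  have hφg : ∀ x, φ x = (g x : ℂ) := fun x => by simp [hφ]
  have e1 : ∫ x, g x • (𝓕 (h2.toLp f : L2R) : L2R) x =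
      ((𝓕 (h2.toLp f : L2R) : L2R) : 𝓢'(ℝ, ℂ)) φ := by
    rw [Lp.toTemperedDistribution_apply]
    simp [hφg]
  have e2 : ((h2.toLp f : L2R) : 𝓢'(ℝ, ℂ)) (𝓕 φ) = ∫ x, (𝓕 φ) x • f x := by
    rw [Lp.toTemperedDistribution_apply]
    refine integral_congr_ae ?_
    filter_upwards [h2.coeFn_toLp] with x hx
    rw [hx]
  rw [e1, ← Lp.fourier_toTemperedDistribution_eq, TemperedDistribution.fourier_apply, e2]
  -- The multiplication formula `∫ 𝓕φ f = ∫ φ 𝓕f`, valid as `φ` and `f` are both in `L¹`.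
  have h := VectorFourier.integral_fourierIntegral_smul_eq_flip (L := innerₗ ℝ) (μ := volume)
    (ν := volume) Real.continuous_fourierChar continuous_inner (φ.integrable (μ := volume)) h1
  have e3 : ∀ x, (𝓕 φ) x = VectorFourier.fourierIntegral Real.fourierChar volume (innerₗ ℝ) φ x :=
    fun x => by rw [SchwartzMap.fourier_coe]; rfl
  have e4 : VectorFourier.fourierIntegral Real.fourierChar volume (innerₗ ℝ).flip f = 𝓕 f := by
    rw [flip_innerₗ]; rfl
  rw [e4] at h
  simp only [e3]
  rw [h]
  simp [hφg]

/-- The character `x ↦ exp(-2πixv)`. -/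
def wave (x v : ℝ) : ℂ := Complex.exp ((-(2 * Real.pi * v : ℝ) * Complex.I) * x)

theorem norm_wave (x v : ℝ) : ‖wave x v‖ = 1 := by
  rw [wave, show (-(2 * Real.pi * v : ℝ) * Complex.I) * x = ((-(2 * Real.pi * v) * x : ℝ) : ℂ) * Complex.I by
    push_cast; ring, Complex.norm_exp_ofReal_mul_I]

theorem continuous_wave : Continuous fun p : ℝ × ℝ => wave p.1 p.2 := by
  unfold wave
  fun_prop

theorem continuous_wave_left (v : ℝ) : Continuous fun x => wave x v := by
  unfold wave
  fun_prop

/-- The Fourier transform of `1_{[0,t]}`. -/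
def waveIntegral (t v : ℝ) : ℂ := ∫ x in (0 : ℝ)..t, wave x v

theorem continuous_waveIntegral (t : ℝ) : Continuous (waveIntegral t) :=
  intervalIntegral.continuous_parametric_intervalIntegral_of_continuous' (f := fun v x => wave x v)
    (continuous_wave.comp continuous_swap) 0 t

theorem waveIntegral_sub (s t v : ℝ) :
    waveIntegral t v - waveIntegral s v = ∫ x in s..t, wave x v :=
  intervalIntegral.integral_interval_sub_left ((continuous_wave_left v).intervalIntegrable _ _)
    ((continuous_wave_left v).intervalIntegrable _ _)

theorem norm_waveIntegral_sub_le (s t v : ℝ) :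
    ‖waveIntegral t v - waveIntegral s v‖ ≤ |t - s| := by
  rw [waveIntegral_sub]
  simpa using intervalIntegral.norm_integral_le_of_norm_le_const (C := 1) (a := s) (b := t)
    (f := fun x => wave x v) fun x _ => (norm_wave x v).le

theorem norm_waveIntegral_le (t v : ℝ) : ‖waveIntegral t v‖ ≤ |t| := by
  simpa [waveIntegral] using norm_waveIntegral_sub_le 0 t v

theorem abs_mul_norm_waveIntegral_le (t v : ℝ) : |2 * Real.pi * v| * ‖waveIntegral t v‖ ≤ 2 := by
  rcases eq_or_ne v 0 with rfl | hv
  · simp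
  have hc : (-(2 * Real.pi * v : ℝ) * Complex.I : ℂ) ≠ 0 := by
    simp [hv, Real.pi_ne_zero]
  have h : waveIntegral t v = (wave t v - wave 0 v) / (-(2 * Real.pi * v : ℝ) * Complex.I) :=
    integral_exp_mul_complex hc
  have hn : ‖(-(2 * Real.pi * v : ℝ) * Complex.I : ℂ)‖ = |2 * Real.pi * v| := by
    rw [norm_mul, norm_neg, Complex.norm_real, Complex.norm_I, mul_one, Real.norm_eq_abs]
  rw [h, norm_div, hn, mul_div_cancel₀]
  · refine (norm_sub_le _ _).trans ?_
    rw [norm_wave, norm_wave]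
    norm_num
  · rw [← hn]
    exact norm_ne_zero_iff.2 hc

/-- Adding the squares of the bounds `|t|` and `2 / |2πv|` produces the weight `1 / (1 + u²)` at `u
= 2πv`, against which `m` is integrable. -/
theorem norm_waveIntegral_sq_le (t v : ℝ) :
    ‖waveIntegral t v‖ ^ 2 ≤ (t ^ 2 + 4) / (1 + (2 * Real.pi * v) ^ 2) := by
  rw [le_div_iff₀ (by positivity)]
  have h1 := pow_le_pow_left₀ (norm_nonneg _) (norm_waveIntegral_le t v) 2
  have h2 := pow_le_pow_left₀ (by positivity) (abs_mul_norm_waveIntegral_le t v) 2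
  rw [mul_pow, sq_abs] at h2
  rw [sq_abs] at h1
  linarith

theorem hasDerivAt_waveIntegral (t v : ℝ) :
    HasDerivAt (fun s => waveIntegral s v) (wave t v) t :=
  intervalIntegral.integral_hasDerivAt_right ((continuous_wave_left v).intervalIntegrable _ _)
    ((continuous_wave_left v).stronglyMeasurableAtFilter _ _) (continuous_wave_left v).continuousAt

theorem fourier_indicator_Icc (a b v : ℝ) :
    𝓕 ((Set.Icc a b).indicator fun _ => (1 : ℂ)) v = ∫ x in Set.Ioc a b, wave x v := by
  rw [Real.fourier_eq', ← integral_Icc_eq_integral_Ioc, ← integral_indicator measurableSet_Icc]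
  refine integral_congr_ae (ae_of_all _ fun x => ?_)
  by_cases hx : x ∈ Set.Icc a b
  · simp only [hx, Set.indicator_of_mem, wave, smul_eq_mul, mul_one]
    congr 1
    simp
    ring
  · simp [hx]

theorem fourier_indicatorConstLp_Icc (a b : ℝ) :
    (𝓕 (indicatorConstLp 2 (measurableSet_Icc (a := a) (b := b)) measure_Icc_lt_top.ne 1 : L2R) :
      L2R) =ᵐ[volume] fun v => ∫ x in Set.Ioc a b, wave x v := by
  have h1 : Integrable ((Set.Icc a b).indicator fun _ => (1 : ℂ)) :=
    (integrable_indicator_iff measurableSet_Icc).2 (integrableOn_const measure_Icc_lt_top.ne)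
  have h2 : MemLp ((Set.Icc a b).indicator fun _ => (1 : ℂ)) 2 :=
    memLp_indicator_const 2 measurableSet_Icc 1 (Or.inr measure_Icc_lt_top.ne)
  refine (fourier_toLp_ae_eq h1 h2).trans (ae_of_all _ fun v => ?_)
  exact fourier_indicator_Icc a b v

theorem fourier_signedIndicator (t : ℝ) :
    (𝓕 (signedIndicator t) : L2R) =ᵐ[volume] waveIntegral t := by
  have e : (𝓕 (signedIndicator t) : L2R) =
      (𝓕 (indicatorConstLp 2 (measurableSet_Icc (a := (0 : ℝ)) (b := t))
        measure_Icc_lt_top.ne 1 : L2R) : L2R) -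
      (𝓕 (indicatorConstLp 2 (measurableSet_Icc (a := t) (b := (0 : ℝ)))
        measure_Icc_lt_top.ne 1 : L2R) : L2R) :=
    (Lp.fourierTransformₗᵢ ℝ ℂ).map_sub _ _
  rw [e]
  refine (Lp.coeFn_sub _ _).trans ?_
  filter_upwards [fourier_indicatorConstLp_Icc 0 t, fourier_indicatorConstLp_Icc t 0] with v h1 h2
  rw [Pi.sub_apply, h1, h2]
  -- An interval integral is by definition the difference of the integrals over `(0,t]` and `(t,0]`,
  -- so the sign convention for `t < 0` matches.
  rfl

theorem fourier_hermiteLp (n : ℕ) :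
    (𝓕 (hermiteLp n) : L2R) =ᵐ[volume] 𝓕 (hermiteC n) :=
  fourier_toLp_ae_eq (integrable_hermiteC n) (memLp_hermiteFun n)

end FourierL2

/-! ### The functions `T_m 1_{[0,t]}` and their Hermite coefficients -/

section Coefficients

variable {m : ℝ → ℝ}

theorem symbolMul_signedIndicator (m : ℝ → ℝ) (t : ℝ) :
    symbolMul m (signedIndicator t) =ᵐ[volume]
      fun v => (Real.sqrt (m (2 * Real.pi * v)) : ℂ) * waveIntegral t v := by
  filter_upwards [fourier_signedIndicator t] with v hv
  rw [symbolMul, hv]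

theorem aemeasurable_comp_two_pi (hm : AEMeasurable m volume) :
    AEMeasurable (fun v => m (2 * Real.pi * v)) volume :=
  hm.comp_quasiMeasurePreserving
    (Measure.quasiMeasurePreserving_smul volume (r := 2 * Real.pi) (by positivity))

theorem memLp_symbolMul_signedIndicator (hm_meas : AEMeasurable m volume) (hm_nonneg : ∀ u, 0 ≤ m u)
    (hm_int : Integrable (fun u : ℝ => m u / (1 + u ^ 2)) volume) (t : ℝ) :
    MemLp (symbolMul m (signedIndicator t)) 2 volume := by
  have hmeas : AEStronglyMeasurable
      (fun v => (Real.sqrt (m (2 * Real.pi * v)) : ℂ) * waveIntegral t v) volume :=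
    ((aemeasurable_comp_two_pi hm_meas).sqrt.complex_ofReal.aestronglyMeasurable).mul
      (continuous_waveIntegral t).aestronglyMeasurable
  rw [memLp_congr_ae (symbolMul_signedIndicator m t), memLp_two_iff_integrable_sq_norm hmeas]
  have hi := (hm_int.comp_mul_left' (by positivity : 2 * Real.pi ≠ 0)).const_mul (t ^ 2 + 4)
  refine hi.mono' (hmeas.norm.pow 2) (ae_of_all _ fun v => ?_)
  rw [Real.norm_of_nonneg (by positivity), norm_mul, mul_pow, Complex.norm_real,
    Real.norm_of_nonneg (Real.sqrt_nonneg _), Real.sq_sqrt (hm_nonneg _)]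
  refine (mul_le_mul_of_nonneg_left (norm_waveIntegral_sq_le t v) (hm_nonneg _)).trans (le_of_eq ?_)
  ring

/-- The pairing of the `n`-th Hermite function with the inverse Fourier transform of `√m k`. -/
def symbolCoeff (m : ℝ → ℝ) (k : ℝ → ℂ) (n : ℕ) : ℂ :=
  ∫ v, starRingEnd ℂ (𝓕 (hermiteC n) v) * ((Real.sqrt (m (2 * Real.pi * v)) : ℂ) * k v)

theorem inner_hermiteLp_opT (n : ℕ) (t : ℝ) (ht : signedIndicator t ∈ (opT m).domain) :
    ⟪hermiteLp n, opT m ⟨signedIndicator t, ht⟩⟫_ℂ = symbolCoeff m (waveIntegral t) n := by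
  have e : opT m ⟨signedIndicator t, ht⟩ =
      (𝓕⁻ (MemLp.toLp (symbolMul m (signedIndicator t)) ht : L2R) : L2R) := rfl
  rw [e, ← Lp.inner_fourier_eq, FourierTransform.fourier_fourierInv_eq, L2.inner_def, symbolCoeff]
  refine integral_congr_ae ?_
  filter_upwards [fourier_hermiteLp n, MemLp.coeFn_toLp ht, symbolMul_signedIndicator m t]
    with v h1 h2 h3
  rw [h1, h2, h3, RCLike.inner_apply, mul_comm]

/-- The part of the integrand of `symbolCoeff` that does not depend on the Hermite function. -/
def symbolMajorant (m : ℝ → ℝ) (N : ℕ) (u : ℝ) : ℝ := Real.sqrt (m u) / (1 + |u| ^ (N + 2))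

theorem integrable_indicator_abs_rpow {s : ℝ} (hs : -1 < s) :
    Integrable ((Set.Icc (-1 : ℝ) 1).indicator fun u => |u| ^ s) := by
  rw [integrable_indicator_iff measurableSet_Icc, ← intervalIntegrable_iff_integrableOn_Icc_of_le
    (by norm_num)]
  have h1 : IntervalIntegrable (fun u : ℝ => |u| ^ s) volume 0 1 :=
    (intervalIntegral.intervalIntegrable_rpow' hs).congr fun u hu => by
      rw [Set.uIoc_of_le zero_le_one] at hu
      simp only [abs_of_pos hu.1]
  have h2 : IntervalIntegrable (fun u : ℝ => |u| ^ s) volume (-1) 0 := by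
    have := (IntervalIntegrable.iff_comp_neg (f := fun u : ℝ => |u| ^ s)).1 h1
    simpa using this.symm
  exact h2.trans h1

theorem integrable_symbolMajorant (hm_meas : AEMeasurable m volume)
    {K b : ℝ} {N : ℕ} (hK : 0 < K) (hb : b < 2)
    (hm_small : ∀ u : ℝ, u ≠ 0 → |u| ≤ 1 → m u ≤ K * |u| ^ (-b))
    (hm_large : ∀ u : ℝ, 1 < |u| → m u ≤ K * |u| ^ (2 * N)) :
    Integrable (symbolMajorant m N) := by
  -- The first term dominates on `|u| ≤ 1`. For `|u| > 1`, `|u|^N / (1 + |u|^{N+2}) ≤ u^{-2} ≤ 2 /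
  -- (1 + u²)`, whence the factor 2.
  have hi := ((integrable_indicator_abs_rpow (s := -b / 2) (by linarith)).add
    (integrable_inv_one_add_sq.const_mul 2)).const_mul (Real.sqrt K)
  refine hi.mono' (hm_meas.sqrt.div (by fun_prop)).aestronglyMeasurable ?_
  filter_upwards [compl_mem_ae_iff.2 (measure_singleton (0 : ℝ))] with u hu
  have hu0 : u ≠ 0 := hu
  have hpos : 0 < |u| := abs_pos.2 hu0
  have hinv : (0 : ℝ) ≤ (1 + u ^ 2)⁻¹ := by positivity
  rw [symbolMajorant, Real.norm_of_nonneg (by positivity)]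
  simp only [Pi.add_apply]
  rcases le_or_gt |u| 1 with h | h
  · have hmem : u ∈ Set.Icc (-1 : ℝ) 1 := abs_le.1 h
    rw [Set.indicator_of_mem hmem]
    have h1 : Real.sqrt (m u) ≤ Real.sqrt K * |u| ^ (-b / 2) := by
      refine (Real.sqrt_le_sqrt (hm_small u hu0 h)).trans (le_of_eq ?_)
      rw [Real.sqrt_mul hK.le, Real.sqrt_eq_rpow (|u| ^ (-b)), ← Real.rpow_mul (abs_nonneg u)]
      congr 2
      ring
    calc Real.sqrt (m u) / (1 + |u| ^ (N + 2)) ≤ Real.sqrt (m u) :=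
          div_le_self (Real.sqrt_nonneg _) (by linarith [pow_pos hpos (N + 2)])
      _ ≤ _ := h1
      _ ≤ _ := mul_le_mul_of_nonneg_left (by linarith) (Real.sqrt_nonneg _)
  · have hmem : u ∉ Set.Icc (-1 : ℝ) 1 := fun h' => absurd (abs_le.2 h') (not_le.2 h)
    rw [Set.indicator_of_notMem hmem, zero_add]
    have h1 : Real.sqrt (m u) ≤ Real.sqrt K * |u| ^ N := by
      refine (Real.sqrt_le_sqrt (hm_large u h)).trans (le_of_eq ?_)
      rw [Real.sqrt_mul hK.le, mul_comm 2 N, pow_mul, Real.sqrt_sq (by positivity)]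
    rw [div_le_iff₀ (by positivity)]
    refine h1.trans ?_
    rw [mul_assoc]
    refine mul_le_mul_of_nonneg_left ?_ (Real.sqrt_nonneg _)
    have h2 : 1 ≤ |u| ^ 2 := one_le_pow₀ h.le
    rw [← sq_abs u, mul_assoc, ← div_eq_inv_mul, ← mul_div_assoc, le_div_iff₀ (by positivity), pow_add]
    nlinarith [pow_pos hpos N]

/-- The sum of the uniform bound and the bound with `|2πv|^{N+2}`. Two powers beyond the growth
`|u|^N` of `√m` make the product integrable at infinity. -/
theorem norm_fourier_hermiteC_le_div (N : ℕ) : ∃ C : ℝ, 0 ≤ C ∧ ∀ (n : ℕ) (v : ℝ),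
    ‖𝓕 (hermiteC n) v‖ ≤ C * ((n : ℝ) + 1) ^ (N + 3) / (1 + |2 * Real.pi * v| ^ (N + 2)) := by
  obtain ⟨C, hC, h⟩ := norm_fourier_hermiteC_mul_pow_le (N + 2)
  refine ⟨6 + C, by positivity, fun n v => ?_⟩
  rw [le_div_iff₀ (by positivity)]
  have h1 := h n v
  have h2 := norm_fourier_hermiteC_le n v
  have h3 : (n : ℝ) + 1 ≤ ((n : ℝ) + 1) ^ (N + 3) :=
    le_self_pow₀ (by linarith [(n.cast_nonneg : (0 : ℝ) ≤ n)]) (by omega)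
  rw [show N + 2 + 1 = N + 3 from rfl] at h1
  linarith

/-- The integrands of `symbolCoeff` have a majorant that is polynomially bounded in `n`. -/
theorem exists_symbolCoeff_majorant (hm_meas : AEMeasurable m volume)
    {K b : ℝ} {N : ℕ} (hK : 0 < K) (hb : b < 2)
    (hm_small : ∀ u : ℝ, u ≠ 0 → |u| ≤ 1 → m u ≤ K * |u| ^ (-b))
    (hm_large : ∀ u : ℝ, 1 < |u| → m u ≤ K * |u| ^ (2 * N)) :
    ∃ G : ℝ → ℝ, Integrable G ∧ ∀ (n : ℕ) (v : ℝ),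
      ‖𝓕 (hermiteC n) v‖ * Real.sqrt (m (2 * Real.pi * v)) ≤ ((n : ℝ) + 1) ^ (N + 3) * G v := by
  obtain ⟨C, hC, h⟩ := norm_fourier_hermiteC_le_div N
  refine ⟨fun v => C * symbolMajorant m N (2 * Real.pi * v),
    ((integrable_symbolMajorant hm_meas hK hb hm_small hm_large).comp_mul_left'
      (by positivity)).const_mul C, fun n v => ?_⟩
  refine (mul_le_mul_of_nonneg_right (h n v) (Real.sqrt_nonneg _)).trans (le_of_eq ?_)
  simp only [symbolMajorant]
  ring

theorem aestronglyMeasurable_symbolCoeff (hm_meas : AEMeasurable m volume) {k : ℝ → ℂ}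
    (hk : Continuous k) (n : ℕ) :
    AEStronglyMeasurable (fun v => starRingEnd ℂ (𝓕 (hermiteC n) v) *
      ((Real.sqrt (m (2 * Real.pi * v)) : ℂ) * k v)) volume :=
  (Complex.continuous_conj.comp (continuous_fourier_of_integrable
    (integrable_hermiteC n))).aestronglyMeasurable.mul
    (((aemeasurable_comp_two_pi hm_meas).sqrt.complex_ofReal.aestronglyMeasurable).mul
      hk.aestronglyMeasurable)

theorem norm_symbolCoeff_integrand_le {G : ℝ → ℝ} {q n : ℕ} {M v : ℝ} {z : ℂ}
    (hG : ‖𝓕 (hermiteC n) v‖ * Real.sqrt (m (2 * Real.pi * v)) ≤ ((n : ℝ) + 1) ^ q * G v)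
    (hz : ‖z‖ ≤ M) :
    ‖starRingEnd ℂ (𝓕 (hermiteC n) v) * ((Real.sqrt (m (2 * Real.pi * v)) : ℂ) * z)‖ ≤
      ((n : ℝ) + 1) ^ q * G v * M := by
  rw [norm_mul, norm_mul, RCLike.norm_conj, Complex.norm_real,
    Real.norm_of_nonneg (Real.sqrt_nonneg _), ← mul_assoc]
  exact mul_le_mul hG hz (norm_nonneg _) ((by positivity : (0 : ℝ) ≤ _).trans hG)

variable {G : ℝ → ℝ} {q : ℕ}

theorem integrable_symbolCoeff (hm_meas : AEMeasurable m volume) (hG : Integrable G)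
    (hbound : ∀ (n : ℕ) (v : ℝ),
      ‖𝓕 (hermiteC n) v‖ * Real.sqrt (m (2 * Real.pi * v)) ≤ ((n : ℝ) + 1) ^ q * G v)
    {k : ℝ → ℂ} (hk : Continuous k) {M : ℝ} (hM : ∀ v, ‖k v‖ ≤ M) (n : ℕ) :
    Integrable (fun v => starRingEnd ℂ (𝓕 (hermiteC n) v) *
      ((Real.sqrt (m (2 * Real.pi * v)) : ℂ) * k v)) :=
  ((hG.const_mul _).mul_const M).mono' (aestronglyMeasurable_symbolCoeff hm_meas hk n)
    (ae_of_all _ fun v => norm_symbolCoeff_integrand_le (hbound n v) (hM v))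

theorem norm_symbolCoeff_le (hG : Integrable G)
    (hbound : ∀ (n : ℕ) (v : ℝ),
      ‖𝓕 (hermiteC n) v‖ * Real.sqrt (m (2 * Real.pi * v)) ≤ ((n : ℝ) + 1) ^ q * G v)
    {k : ℝ → ℂ} (hM : ∀ v, ‖k v‖ ≤ 1) (n : ℕ) :
    ‖symbolCoeff m k n‖ ≤ (∫ v, G v) * ((n : ℝ) + 1) ^ q := by
  rw [mul_comm, ← integral_const_mul]
  refine norm_integral_le_of_norm_le (hG.const_mul _) (ae_of_all _ fun v => ?_)
  simpa using norm_symbolCoeff_integrand_le (hbound n v) (hM v)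

theorem symbolCoeff_smul_sub (hm_meas : AEMeasurable m volume) (hG : Integrable G)
    (hbound : ∀ (n : ℕ) (v : ℝ),
      ‖𝓕 (hermiteC n) v‖ * Real.sqrt (m (2 * Real.pi * v)) ≤ ((n : ℝ) + 1) ^ q * G v)
    (r s t : ℝ) (n : ℕ) :
    symbolCoeff m (fun v => r • (waveIntegral s v - waveIntegral t v)) n =
      r • (symbolCoeff m (waveIntegral s) n - symbolCoeff m (waveIntegral t) n) := by
  have hi : ∀ t, _ := fun t => integrable_symbolCoeff hm_meas hG hbound
    (continuous_waveIntegral t) (norm_waveIntegral_le t) n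
  rw [symbolCoeff, symbolCoeff, symbolCoeff, ← integral_sub (hi s) (hi t), ← integral_smul]
  refine integral_congr_ae (ae_of_all _ fun v => ?_)
  simp only [Complex.real_smul]
  ring

/-- Uniform in `h` and `v`, hence the domination for the difference quotients; `h = 0` is included
because `0⁻¹ = 0`. -/
theorem norm_slope_waveIntegral_le (t h v : ℝ) :
    ‖h⁻¹ • (waveIntegral (t + h) v - waveIntegral t v)‖ ≤ 1 := by
  rw [norm_smul, norm_inv, Real.norm_eq_abs]
  have h1 := norm_waveIntegral_sub_le t (t + h) v
  rw [add_sub_cancel_left] at h1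
  exact (mul_le_mul_of_nonneg_left h1 (by positivity)).trans (inv_mul_le_one (a := |h|))

theorem tendsto_symbolCoeff_slope (hm_meas : AEMeasurable m volume) (hG : Integrable G)
    (hbound : ∀ (n : ℕ) (v : ℝ),
      ‖𝓕 (hermiteC n) v‖ * Real.sqrt (m (2 * Real.pi * v)) ≤ ((n : ℝ) + 1) ^ q * G v)
    (t : ℝ) (n : ℕ) :
    Tendsto (fun h : ℝ => symbolCoeff m
        (fun v => h⁻¹ • (waveIntegral (t + h) v - waveIntegral t v)) n)
      (𝓝[≠] 0) (𝓝 (symbolCoeff m (wave t) n)) := by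
  have hcont : ∀ h : ℝ,
      Continuous fun v => h⁻¹ • (waveIntegral (t + h) v - waveIntegral t v) := fun h =>
    ((continuous_waveIntegral (t + h)).sub (continuous_waveIntegral t)).const_smul h⁻¹
  refine tendsto_integral_filter_of_dominated_convergence
    (fun v => ((n : ℝ) + 1) ^ q * G v * 1)
    (Eventually.of_forall fun h => aestronglyMeasurable_symbolCoeff hm_meas (hcont h) n)
    (Eventually.of_forall fun h => ae_of_all _ fun v =>
      norm_symbolCoeff_integrand_le (hbound n v) (norm_slope_waveIntegral_le t h v))
    ((hG.const_mul _).mul_const 1) (ae_of_all _ fun v => ?_)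
  exact ((hasDerivAt_waveIntegral t v).tendsto_slope_zero.const_mul _).const_mul _

end Coefficients

/-! ### Convergence in weighted `ℓ²` spaces -/

section Limit

theorem coeff_real_smul {ι : Type} (a : ι → ℝ) [Fact (∀ i, 0 < a i)] (r : ℝ) (f : WeightedL2 a)
    (i : ι) : coeff a (r • f) i = r • coeff a f i := by
  rw [← Complex.coe_smul, map_smul, Pi.smul_apply, Complex.coe_smul]

/-- Dominated convergence in a weighted `ℓ²` space. -/
theorem tendsto_weightedL2_of_dominated {ι α : Type} (a : ι → ℝ) [ha : Fact (∀ i, 0 < a i)]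
    {l : Filter α} {x : α → WeightedL2 a} {x₀ : WeightedL2 a} {B : ι → ℝ}
    (hB : Summable fun i => B i ^ 2 * a i) (hx : ∀ s i, ‖coeff a (x s) i‖ ≤ B i)
    (hx₀ : ∀ i, ‖coeff a x₀ i‖ ≤ B i)
    (hlim : ∀ i, Tendsto (fun s => coeff a (x s) i) l (𝓝 (coeff a x₀ i))) :
    Tendsto x l (𝓝 x₀) := by
  rw [tendsto_iff_norm_sub_tendsto_zero]
  have h1 : Tendsto (fun s => ∑' i, ‖coeff a (x s - x₀) i‖ ^ 2 * a i) l (𝓝 (∑' _ : ι, (0 : ℝ))) := by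
    refine tendsto_tsum_of_dominated_convergence (hB.mul_left 4) (fun i => ?_)
      (Eventually.of_forall fun s i => ?_)
    · have h := (((hlim i).sub_const (coeff a x₀ i)).norm.pow 2).mul_const (a i)
      simpa using h
    · rw [Real.norm_of_nonneg (mul_nonneg (sq_nonneg _) (ha.out i).le), ← mul_assoc]
      refine mul_le_mul_of_nonneg_right ?_ (ha.out i).le
      have h2 : ‖coeff a (x s - x₀) i‖ ≤ 2 * B i := by
        rw [map_sub, Pi.sub_apply]
        exact (norm_sub_le _ _).trans (by linarith [hx s i, hx₀ i])
      exact (pow_le_pow_left₀ (norm_nonneg _) h2 2).trans (le_of_eq (by ring))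
  rw [tsum_zero] at h1
  have h3 := h1.sqrt
  simpa only [← norm_sq_eq, Real.sqrt_sq (norm_nonneg _), Real.sqrt_zero] using h3

/-- The exponent `2q + 2` cancels the squared growth `(n+1)^{2q}` and leaves `(n+1)^{-2}`. -/
theorem summable_hermiteWeight_neg (A : ℝ) (q : ℕ) :
    Summable fun n : ℕ => (A * ((n : ℝ) + 1) ^ q) ^ 2 *
      hermiteWeight (-((2 * q + 2 : ℕ) : ℤ)) n := by
  have h : Summable fun n : ℕ => A ^ 2 * (1 / ((n : ℝ) + 1) ^ 2) := by
    have := (summable_nat_add_iff 1).2 (Real.summable_one_div_nat_pow.2 one_lt_two)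
    exact (this.congr fun n => by push_cast; rfl).mul_left _
  have hpos := (inferInstance : Fact (∀ n, 0 < hermiteWeight (-((2 * q + 2 : ℕ) : ℤ)) n)).out
  refine h.of_nonneg_of_le (fun n => mul_nonneg (sq_nonneg _) (hpos n).le) fun n => ?_
  have hn : (0 : ℝ) < (n : ℝ) + 1 := by positivity
  have e : hermiteWeight (-((2 * q + 2 : ℕ) : ℤ)) n ≤ (((n : ℝ) + 1) ^ (2 * q + 2))⁻¹ := by
    rw [hermiteWeight, zpow_neg, zpow_natCast]
    gcongr
    linarith
  refine (mul_le_mul_of_nonneg_left e (sq_nonneg _)).trans (le_of_eq ?_)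
  rw [pow_add]
  field_simp
  ring

theorem coeff_hermiteCoeff (g : L2R) (n : ℕ) :
    coeff (hermiteWeight 0) (hermiteCoeff g) n = ⟪hermiteLp n, g⟫_ℂ := rfl

theorem hermiteWeight_neg_le (p : ℕ) (n : ℕ) :
    hermiteWeight (-(p : ℤ)) n ≤ hermiteWeight 0 n := by
  unfold hermiteWeight
  exact zpow_le_zpow_right₀ (by linarith [(Nat.cast_nonneg n : (0 : ℝ) ≤ n)]) (by omega)

end Limit

end FreeNoise

end

/-! ### Differentiability of the process -/

open FreeNoise in
theorem theorem7p2 (m : ℝ → ℝ) (hm_meas : AEMeasurable m volume) (hm_nonneg : ∀ u, 0 ≤ m u)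
    (hm_int : Integrable (fun u : ℝ => m u / (1 + u ^ 2)) volume)
    (K b : ℝ) (N : ℕ) (hK : 0 < K) (hb : b < 2)
    (hm_small : ∀ u : ℝ, u ≠ 0 → |u| ≤ 1 → m u ≤ K * |u| ^ (-b))
    (hm_large : ∀ u : ℝ, 1 < |u| → m u ≤ K * |u| ^ (2 * N)) :
    ∃ hdom : ∀ t : ℝ, signedIndicator t ∈ (opT m).domain,
      ∃ W : ℝ → (TestSpace →L[ℂ] DistributionSpace),
        ∀ (f : TestSpace) (t : ℝ),
          Tendsto
            (fun h : ℝ => h⁻¹ •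
              (whiteNoiseToDistribution (freeProcess m hdom (t + h) (testToWhiteNoise f)) -
                whiteNoiseToDistribution (freeProcess m hdom t (testToWhiteNoise f))))
            (𝓝[≠] 0) (𝓝 (W t f)) := by
  have hdom : ∀ t : ℝ, signedIndicator t ∈ (opT m).domain :=
    memLp_symbolMul_signedIndicator hm_meas hm_nonneg hm_int
  obtain ⟨G, hG, hbound⟩ := exists_symbolCoeff_majorant hm_meas hK hb hm_small hm_large
  let q : ℕ := N + 3
  let p : ℕ := 2 * q + 2
  let B : ℕ → ℝ := fun n => (∫ v, G v) * ((n : ℝ) + 1) ^ q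
  have hB : Summable fun n => B n ^ 2 * hermiteWeight (-(p : ℤ)) n :=
    summable_hermiteWeight_neg _ q
  have hle : ∀ {k : ℝ → ℂ}, (∀ v, ‖k v‖ ≤ 1) → ∀ n, ‖symbolCoeff m k n‖ ≤ B n :=
    fun hk n => norm_symbolCoeff_le hG hbound hk n
  have hwave : ∀ t n, ‖symbolCoeff m (wave t) n‖ ≤ B n := fun t => hle fun v => (norm_wave t v).le
  have hsum : ∀ t, Summable fun n => ‖symbolCoeff m (wave t) n‖ ^ 2 * hermiteWeight (-(p : ℤ)) n :=
    fun t => hB.of_nonneg_of_le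
      (fun n => mul_nonneg (sq_nonneg _)
        ((inferInstance : Fact (∀ n, 0 < hermiteWeight (-(p : ℤ)) n)).out n).le)
      (fun n => mul_le_mul_of_nonneg_right (pow_le_pow_left₀ (norm_nonneg _) (hwave t n) 2)
        ((inferInstance : Fact (∀ n, 0 < hermiteWeight (-(p : ℤ)) n)).out n).le)
  -- Formally `D t` is `T_m δ_t`, the derivative of `T_m 1_{[0,t]}`, while `c t` is `T_m 1_{[0,t]}`
  -- itself viewed in `H_{-p}`.
  let D : ℝ → HermiteSpace (-(p : ℤ)) := fun t => ofCoeff _ (symbolCoeff m (wave t)) (hsum t)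
  let c : ℝ → HermiteSpace (-(p : ℤ)) := fun t =>
    weightedInclusion (hermiteWeight (-(p : ℤ))) (hermiteWeight 0) (hermiteWeight_neg_le p)
      (hermiteCoeff (opT m ⟨signedIndicator t, hdom t⟩))
  have hc : ∀ t n, coeff (hermiteWeight (-(p : ℤ))) (c t) n = symbolCoeff m (waveIntegral t) n := by
    intro t n
    rw [coeff_weightedInclusion, coeff_hermiteCoeff, inner_hermiteLp_opT]
  have hslope : ∀ t h n, coeff (hermiteWeight (-(p : ℤ))) (h⁻¹ • (c (t + h) - c t)) n =
      symbolCoeff m (fun v => h⁻¹ • (waveIntegral (t + h) v - waveIntegral t v)) n := by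
    intro t h n
    rw [coeff_real_smul, map_sub, Pi.sub_apply, hc, hc,
      symbolCoeff_smul_sub hm_meas hG hbound]
  have hX : ∀ t f, whiteNoiseToDistribution (freeProcess m hdom t (testToWhiteNoise f)) =
      distributionField p (c t) f := fun t f =>
    whiteNoise_freeField p _ (c t) (coeff_weightedInclusion _ _ _ _) f
  refine ⟨hdom, fun t => distributionField p (D t), fun f t => ?_⟩
  -- Real linearity of the field moves the difference quotient onto the vectors `c t`.
  simp only [hX, ← distributionField_sub, ← distributionField_smul]
  refine tendsto_distributionField p (tendsto_weightedL2_of_dominated _ hB (fun h n => ?_)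
    (fun n => ?_) fun n => ?_) f
  · rw [hslope]
    exact hle (norm_slope_waveIntegral_le t h) n
  · rw [coeff_ofCoeff]
    exact hwave t n
  · simp only [hslope]
    rw [coeff_ofCoeff]
    exact tendsto_symbolCoeff_slope hm_meas hG hbound t n
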